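/- Let $d\in\mathbb N$ and let $\sqrt i:=(1+i)/\sqrt2$. Let $\mu$ be a finite Borel measure on $[0,\infty)$ and $$\rho(z):=\int_{[0,\infty)}e^{-(\lambda z)^2/2}\,\mu(d\lambda),\qquad z\in\mathbb C,\ \operatorname{Re}z^2\ge 0 .$$ Let $\{V(x)\}_{x\in\mathbb R^d}$ be a real, zero-mean Gaussian random field on a probability space $(\Omega,\mathcal A,\mathbb P)$, with expectation $\mathbb E$ and covariance $\mathbb E[V(x+y)V(y)]=R(x)=\rho(|x|)$ for all $x,y\in\mathbb R^d$. Extend $R$ to complex multiples of real vectors by $R(zx):=\rho(z|x|)$ for $x\in\mathbb R^d$, $\operatorname{Re}z^2\ge0$. Let $\phi_0\in L^1(\mathbb R^d)$ (in particular, $\phi_0\in C_c^\infty(\mathbb R^d)$ is allowed), and let $\widehat f(\xi)=\int_{\mathbb R^d}f(x)e^{-i\xi\cdot x}\,dx$. The solution $\phi$ of the random Schrödinger equation $$i\partial_t\phi+\tfrac12\Delta\phi-V(x)\phi=0,\qquad \phi(0,x)=\phi_0(x),$$ is understood through its Duhamel series: for every $t\ge0$ and $\xi\in\mathbb R^d$,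 $$\widehat\phi(t,\xi)=\sum_{n=0}^\infty\int_{0\le s_n\le\dots\le s_1\le t}\int_{\mathbb R^{nd}}\prod_{j=1}^n\frac{\widehat V(dp_j)}{i(2\pi)^d}\;e^{-\frac i2|\xi|^2(t-s_1)-\frac i2|\xi-p_1|^2(s_1-s_2)-\dots-\frac i2|\xi-p_1-\dots-p_n|^2s_n}\;\widehat\phi_0(\xi-p_1-\dots-p_n)\,ds,$$ where the series converges in $L^2(\Omega)$ and the time integrals are Bochner integrals in $L^2(\Omega)$. Here $\widehat V$ is the random spectral measure of $V$, that is, $V(x)=\int e^{ip\cdot x}\,\widehat V(dp)/(2\pi)^d$, and products of $\widehat V$ are ordinary products: an element $J$ of $L^2(\Omega)$ is the integral $\int F(p_1,\dots,p_n)\prod_{j=1}^n\widehat V(dp_j)/(2\pi)^{d}$ if it is the $L^2(\Omega)$-limit of $\sum_x c^{(k)}_x\prod_{j=1}^nV(x_j)$ as $k\to\infty$, for some uniformly bounded sequence of trigonometric polynomials $\sum_x c^{(k)}_x e^{i\sum_j p_j\cdot x_j}$ (finite sums over $x=(x_1,\dots,x_n)\in(\mathbb R^d)^n$) converging pointwise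 to $F$. Then there is exactly one such solution $\widehat\phi$, with $\widehat\phi(t,\xi)\in L^2(\Omega)$ for every $t\ge0$, $\xi\in\mathbb R^d$. Moreover, if $\{B_t\}_{t\ge0}$ is a standard $d$-dimensional Brownian motion started from the origin, on a probability space with expectation $\mathbb E_{\mathrm B}$, then for every $t\ge 0$ and $\xi\in\mathbb R^d$ the random variables under both expectations below are integrable and $$\mathbb E[\widehat\phi(t,\xi)]=\widehat\phi_0(\xi)\,\mathbb E_{\mathrm B}\left[\exp\left\{i\sqrt i\,\xi\cdot B_t-\frac12\int_{[0,t]^2}R\big(\sqrt i\,(B_s-B_u)\big)\,du\,ds\right\}\right].$$ -/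

import Mathlib

open MeasureTheory ProbabilityTheory Filter Topology
open scoped NNReal ENNReal

noncomputable section

namespace AverageWave

/-- The square root `√i = (1 + i) / √2`. -/
def sqrtI : ℂ := (1 + Complex.I) / ((Real.sqrt 2 : ℝ) : ℂ)

/-- The Schoenberg function `ρ(z) = ∫_{[0,∞)} exp(-(λ z)² / 2) μ(dλ)`, for complex `z`.
The integrand is bounded by `1` when `Re z² ≥ 0`. -/
def rho (μ : Measure ℝ≥0) (z : ℂ) : ℂ :=
  ∫ l : ℝ≥0, Complex.exp (-(((l : ℝ) : ℂ) * z) ^ 2 / 2) ∂μ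

/-- The extension `R(z x) = ρ(z |x|)` of the covariance function `R(x) = ρ(|x|)` to complex
multiples `z x` of vectors `x ∈ ℝ^d` (with `Re z² ≥ 0`). -/
def extR {d : ℕ} (μ : Measure ℝ≥0) (z : ℂ) (x : EuclideanSpace ℝ (Fin d)) : ℂ :=
  rho μ (z * ((‖x‖ : ℝ) : ℂ))

/-- The Fourier transform `f̂(ξ) = ∫ f(x) exp(-i ξ·x) dx`. -/
def fourierHat {d : ℕ} (f : EuclideanSpace ℝ (Fin d) → ℂ) (ξ : EuclideanSpace ℝ (Fin d)) : ℂ :=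
  ∫ x, f x * Complex.exp (-Complex.I * ((inner ℝ ξ x : ℝ) : ℂ))

/-- A standard `d`-dimensional Brownian motion (started from the origin): the coordinates are
independent real standard Brownian motions. -/
structure IsStandardBrownian {d : ℕ} {S : Type*} [MeasurableSpace S]
    (B : ℝ≥0 → S → EuclideanSpace ℝ (Fin d)) (Q : Measure S) : Prop where
  coord : ∀ j : Fin d, IsBrownianReal (fun t ω => B t ω j) Q
  indep : iIndepFun (fun (j : Fin d) (ω : S) (t : ℝ≥0) => B t ω j) Q

/-- A trigonometric polynomial on `(ℝ^d)^n`, given by finitely many frequencies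
`x = (x₁, …, xₙ)` with complex coefficients `c_x`; its value at `p = (p₁, …, pₙ)` is
`∑_x c_x exp(i ∑_j p_j·x_j)`. -/
def trigSymbol {d n : ℕ} (T : (Fin n → EuclideanSpace ℝ (Fin d)) →₀ ℂ)
    (p : Fin n → EuclideanSpace ℝ (Fin d)) : ℂ :=
  T.sum fun x c => c * Complex.exp (Complex.I * ((∑ j, inner ℝ (p j) (x j) : ℝ) : ℂ))

/-- The integral of a trigonometric polynomial against `∏_j V̂(dp_j) / (2π)^d`. Since
`V(x) = ∫ exp(i p·x) V̂(dp) / (2π)^d`, it is `∑_x c_x ∏_j V(x_j)`. -/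
def trigEval {d n : ℕ} {Ω : Type*} (V : EuclideanSpace ℝ (Fin d) → Ω → ℝ)
    (T : (Fin n → EuclideanSpace ℝ (Fin d)) →₀ ℂ) (ω : Ω) : ℂ :=
  T.sum fun x c => c * ∏ j, ((V (x j) ω : ℝ) : ℂ)

/-- `J = ∫ F(p₁, …, pₙ) V̂(dp₁) ⋯ V̂(dpₙ) / (2π)^{nd}`, where `V̂` is the random spectral
measure of the field `V`, i.e. `V(x) = ∫ exp(i p·x) V̂(dp) / (2π)^d`, and the products of `V̂` are
ordinary products (no Wick ordering, the diagonals are not removed).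

The integral is defined on trigonometric polynomials by the spectral representation of `V`, and it
is extended by continuity: `J` is the limit in `L²(Ω)` of the integrals of a uniformly bounded
sequence of trigonometric polynomials that converges pointwise to `F`. -/
def IsSpectralIntegral {d n : ℕ} {Ω : Type*} [MeasurableSpace Ω]
    (V : EuclideanSpace ℝ (Fin d) → Ω → ℝ) (P : Measure Ω)
    (F : (Fin n → EuclideanSpace ℝ (Fin d)) → ℂ) (J : Lp ℂ 2 P) : Prop :=
  ∃ T : ℕ → ((Fin n → EuclideanSpace ℝ (Fin d)) →₀ ℂ),
    (∃ C : ℝ, ∀ k p, ‖trigSymbol (T k) p‖ ≤ C) ∧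
    (∀ p, Tendsto (fun k => trigSymbol (T k) p) atTop (𝓝 (F p))) ∧
    Tendsto (fun k => eLpNorm (fun ω => trigEval V (T k) ω - J ω) 2 P) atTop (𝓝 0)

/-- The ordered simplex `{(s₁, …, sₙ) : 0 ≤ sₙ ≤ … ≤ s₁ ≤ t}`. -/
def timeSimplex (n : ℕ) (t : ℝ) : Set (Fin n → ℝ) :=
  {s | Antitone s ∧ ∀ j, 0 ≤ s j ∧ s j ≤ t}

/-- The times `(s₀, s₁, …, sₙ, sₙ₊₁)` with `s₀ = t` and `sₙ₊₁ = 0`. -/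
def timeGrid {n : ℕ} (t : ℝ) (s : Fin n → ℝ) : Fin (n + 2) → ℝ :=
  Fin.cons (α := fun _ => ℝ) t (Fin.snoc (α := fun _ => ℝ) s 0)

/-- The integrand of the `n`-th Duhamel term (without the factors `V̂(dp_j) / (i (2π)^d)`):
`exp(-(i/2) (|ξ|²(t - s₁) + |ξ - p₁|²(s₁ - s₂) + … + |ξ - p₁ - … - pₙ|² sₙ))
  φ̂₀(ξ - p₁ - … - pₙ)`. -/
def duhamelKernel {d n : ℕ} (φ₀ : EuclideanSpace ℝ (Fin d) → ℂ) (t : ℝ)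
    (ξ : EuclideanSpace ℝ (Fin d)) (s : Fin n → ℝ)
    (p : Fin n → EuclideanSpace ℝ (Fin d)) : ℂ :=
  Complex.exp (-(Complex.I / 2) *
      ((∑ j : Fin (n + 1), ‖ξ - ∑ l : Fin n with l.castSucc < j, p l‖ ^ 2 *
        (timeGrid t s j.castSucc - timeGrid t s j.succ) : ℝ) : ℂ)) *
    fourierHat φ₀ (ξ - ∑ l, p l)

/-- `φ` is the Fourier transform (in the space variable) of the solution of
`i ∂ₜφ + ½ Δφ - V φ = 0`, `φ(0, ·) = φ₀`, understood as the sum of its Duhamel series: for all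
`(t, ξ)`,
`φ̂(t, ξ) = ∑_n ∫_{0 ≤ sₙ ≤ … ≤ s₁ ≤ t} ∫ ∏_j V̂(dp_j) / (i (2π)^d) K_n(t, ξ, s, p) ds`
with `K_n` the kernel `duhamelKernel`; the time integral is a Bochner integral in `L²(Ω)` and the
series converges in `L²(Ω)`. -/
def IsDuhamelSolution {d : ℕ} {Ω : Type*} [MeasurableSpace Ω]
    (V : EuclideanSpace ℝ (Fin d) → Ω → ℝ) (P : Measure Ω)
    (φ₀ : EuclideanSpace ℝ (Fin d) → ℂ)
    (φ : ℝ≥0 → EuclideanSpace ℝ (Fin d) → Lp ℂ 2 P) : Prop :=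
  ∀ (t : ℝ≥0) (ξ : EuclideanSpace ℝ (Fin d)),
    ∃ J : (n : ℕ) → (Fin n → ℝ) → Lp ℂ 2 P,
      (∀ n, ∀ s ∈ timeSimplex n t, IsSpectralIntegral V P (duhamelKernel φ₀ t ξ s) (J n s)) ∧
      (∀ n, IntegrableOn (J n) (timeSimplex n t)) ∧
      HasSum (fun n => (1 / Complex.I) ^ n • ∫ s in timeSimplex n t, J n s) (φ t ξ)

/-- The random variable
`exp(i √i ξ·B_t - ½ ∫_{[0,t]²} R(√i (B_s - B_u)) du ds)`. -/
def feynmanKacWeight {d : ℕ} {S : Type*} (μ : Measure ℝ≥0)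
    (B : ℝ≥0 → S → EuclideanSpace ℝ (Fin d)) (t : ℝ≥0) (ξ : EuclideanSpace ℝ (Fin d))
    (ω : S) : ℂ :=
  Complex.exp (Complex.I * sqrtI * ((inner ℝ ξ (B t ω) : ℝ) : ℂ) -
    (1 / 2) * ∫ q : ℝ × ℝ in Set.Icc 0 (t : ℝ) ×ˢ Set.Icc 0 (t : ℝ),
      extR μ sqrtI (B q.1.toNNReal ω - B q.2.toNNReal ω))

end AverageWave

end

/-! Write `m_n` for the sum over all pairings of `n` momenta (`momentMeasure`). Wick's theorem,
obtained by iterating Gaussian integration by parts, says that the moments of `V` are Fourier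
transforms of `m_n`. Since `V` is real, the `L²` inner product of two spectral integrals with
symbols `F`, `G` is the integral of `F(p) conj G(-p')` against `m_{n+m}`
(`IsSpectralIntegral.inner_eq`). This gives uniqueness of spectral integrals, their existence for
bounded continuous symbols, and their continuity in the time variables. With `M` the mass of the
spectral measure, `m_{2n}` has mass at most `(2M)^n n!` and the simplex has volume `t^n/n!`, so the
Duhamel series converges in `L²`.

Under `m_n` the momenta add up to zero, so averaging the `n`-th Duhamel term leaves `φ̂₀(ξ)` times
`i⁻ⁿ` times `expansionTerm` at `z = √i`, the integral of `exp(-(z²/2) Φ)` with `Φ = phaseForm`. For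
real `z` this exponential is the Brownian expectation of `exp(iz(ξ·B_t - ∑ p_l·B_{s_l}))`, by
summation by parts and independence of increments. Fubini then puts the Brownian expectation
outermost. For a fixed path the remaining integrand is symmetric in the times, so the simplex
integral is the cube integral divided by `n!`; the cube integrals satisfy the Gaussian moment
recursion `M_{n+2} = (n+1) c M_n`, with `c` the path energy. The series sums to `exp(-c/2)`, which
is the Feynman-Kac formula for real `z` (`hasSum_expansionTerm_ofReal`).

The value `z = √i` is reached by continuation. Both sides are holomorphic for `|arg z| < π/4`, `|z|
< 2`, and continuous up to the boundary ray containing `√i`: there `Re z² ≥ 0`, so the kernels stay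
bounded by `1`, and `exp(izξ·B_t)` is dominated by Gaussian exponential moments. The identity
theorem and a boundary limit conclude (`IsSectorial.eq_at_sqrtI`). -/

noncomputable section

namespace AverageWave

/-! ### Gaussian integration by parts. -/

/-- Stein's identity for polynomials. -/
lemma integral_mul_eval_gaussianReal (v : ℝ≥0) (p : Polynomial ℝ) :
    ∫ x, x * p.eval x ∂(gaussianReal 0 v) = v * ∫ x, p.derivative.eval x ∂(gaussianReal 0 v) := by
  have hint : ∀ q : Polynomial ℝ, Integrable (fun x => q.eval x) (gaussianReal 0 v) := by
    intro q
    induction q using Polynomial.induction_on' with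
    | add a b ha hb =>
      simp only [Polynomial.eval_add]
      exact ha.add hb
    | monomial n a =>
      simp only [Polynomial.eval_monomial]
      refine Integrable.const_mul ?_ a
      have := (memLp_id_gaussianReal' (μ := 0) (v := v) (n : ℝ≥0∞) (by simp)).integrable_norm_pow'
      refine (integrable_norm_iff (by fun_prop)).1 (by simpa using this)
  rcases eq_or_ne v 0 with rfl | hv
  · simp
  have hv' : (v : ℝ) ≠ 0 := by exact_mod_cast hv
  have hint' : ∀ q : Polynomial ℝ, Integrable (fun x => gaussianPDFReal 0 v x * q.eval x) := by
    intro q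
    have := hint q
    rw [gaussianReal_of_var_ne_zero _ hv, integrable_withDensity_iff_integrable_smul' (by fun_prop)
      (by simp [gaussianPDF])] at this
    simpa [toReal_gaussianPDF] using this
  have hder : ∀ x, HasDerivAt (gaussianPDFReal 0 v) (-(x / v) * gaussianPDFReal 0 v x) x := by
    intro x
    rw [gaussianPDFReal_def]
    have h1 : HasDerivAt (fun x : ℝ => -(x - 0) ^ 2 / (2 * (v : ℝ))) (-(x / v)) x := by
      have := (((hasDerivAt_id x).sub_const 0).pow 2).neg.div_const (2 * (v : ℝ))
      refine this.congr_deriv ?_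
      simp
      field_simp
    refine (h1.exp.const_mul _).congr_deriv ?_
    ring
  rw [integral_gaussianReal_eq_integral_smul hv, integral_gaussianReal_eq_integral_smul hv]
  have := integral_mul_deriv_eq_deriv_mul_of_integrable
    (u := fun x => p.eval x) (u' := fun x => p.derivative.eval x) (v := gaussianPDFReal 0 v)
    (v' := fun x => -(x / v) * gaussianPDFReal 0 v x)
    (fun x _ => p.hasDerivAt x) (fun x _ => hder x) ?_ ?_ ?_
  · have h2 : ∫ x, p.eval x * (-(x / v) * gaussianPDFReal 0 v x) =
      -(v : ℝ)⁻¹ * ∫ x, gaussianPDFReal 0 v x • (x * p.eval x) := by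
      rw [← integral_const_mul]
      congr 1; ext x; simp; field_simp
    rw [h2] at this
    have h3 : ∫ x, p.derivative.eval x * gaussianPDFReal 0 v x =
      ∫ x, gaussianPDFReal 0 v x • p.derivative.eval x := by
      congr 1; ext x; simp; ring
    rw [h3] at this
    field_simp at this
    linarith
  · have h := (hint' (Polynomial.X * p)).const_mul (-(v : ℝ)⁻¹)
    refine h.congr (ae_of_all _ fun x => ?_)
    simp; field_simp
  · refine (hint' p.derivative).congr (ae_of_all _ fun x => ?_)
    simp; ring
  · refine (hint' p).congr (ae_of_all _ fun x => ?_)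
    simp; ring

section Moments

variable {Ω T : Type*} [MeasurableSpace Ω] {P : Measure Ω} {X : T → Ω → ℝ}

/-- Products of Gaussian variables lie in every `L^p`, `p < ∞`. -/
lemma _root_.ProbabilityTheory.IsGaussianProcess.memLp_prod (hX : IsGaussianProcess X P)
    {ι : Type*} (s : Finset ι) (x : ι → T) {p : ℝ≥0∞} (hp : p ≠ ∞) :
    MemLp (fun ω => ∏ j ∈ s, X (x j) ω) p P := by
  have := hX.isProbabilityMeasure
  rcases s.eq_empty_or_nonempty with rfl | hs
  · simpa using memLp_const 1
  -- Hölder's inequality with `s.card` factors, each taken in `L^q` with `q = s.card * p`.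
  refine (MemLp.prod' (p := fun _ => s.card * p) fun j _ =>
    (hX.hasGaussianLaw_eval (x j)).memLp (ENNReal.mul_ne_top (by simp) hp)).mono_exponent ?_
  have h0 : (s.card : ℝ≥0∞) ≠ 0 := by simpa using hs.ne_empty
  rw [Finset.sum_const, nsmul_eq_mul, ENNReal.mul_inv (.inl h0) (.inl (by simp)), inv_inv, ← mul_assoc,
    ENNReal.inv_mul_cancel h0 (by simp), one_mul]

lemma _root_.ProbabilityTheory.IsGaussianProcess.integrable_prod (hX : IsGaussianProcess X P)
    {ι : Type*} (s : Finset ι) (x : ι → T) :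
    Integrable (fun ω => ∏ j ∈ s, X (x j) ω) P :=
  memLp_one_iff_integrable.1 (hX.memLp_prod s x (by simp))

/-- Gaussian integration by parts for a product of jointly Gaussian centered variables. -/
lemma _root_.ProbabilityTheory.IsGaussianProcess.integral_mul_prod (hX : IsGaussianProcess X P)
    (h0 : ∀ t, ∫ ω, X t ω ∂P = 0) {ι : Type*} [Fintype ι] [DecidableEq ι] (t : T) (x : ι → T) :
    ∫ ω, X t ω * ∏ j, X (x j) ω ∂P =
      ∑ k, (∫ ω, X t ω * X (x k) ω ∂P) * ∫ ω, ∏ j ∈ Finset.univ.erase k, X (x j) ω ∂P := by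
  have := hX.isProbabilityMeasure
  have hL2 : ∀ t, MemLp (X t) 2 P := fun t => (hX.hasGaussianLaw_eval t).memLp_two
  have hcov : ∀ s t, cov[X s, X t; P] = ∫ ω, X s ω * X t ω ∂P := by
    intro s t
    rw [covariance_eq_sub (hL2 s) (hL2 t), h0, h0]; simp
  set σ2 : ℝ := ∫ ω, X t ω * X t ω ∂P with hσ2
  have hvar : Var[X t; P] = σ2 := by rw [← covariance_self (hX.aemeasurable t), hcov]
  have hσ0 : 0 ≤ σ2 := hvar ▸ variance_nonneg _ _
  -- Regression coefficients on `X t`. If `σ2 = 0`, division by zero makes them `0`, and `hcσ`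
  -- survives because `X t` vanishes almost surely.
  set c : ι → ℝ := fun k => (∫ ω, X t ω * X (x k) ω ∂P) / σ2 with hc
  have hcσ : ∀ k, c k * σ2 = ∫ ω, X t ω * X (x k) ω ∂P := by
    intro k
    rcases eq_or_ne σ2 0 with h | h
    · have h1 : X t =ᵐ[P] 0 := by
        have : ∀ ω, 0 ≤ X t ω * X t ω := fun ω => mul_self_nonneg _
        have h2 := (integral_eq_zero_iff_of_nonneg this ((hL2 t).integrable_mul (hL2 t))).1 h
        filter_upwards [h2] with ω hω
        simpa using hω
      rw [h, mul_zero, eq_comm]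
      refine integral_eq_zero_of_ae ?_
      filter_upwards [h1] with ω hω
      simp [hω]
    · simp [hc, h]
  -- The residuals are uncorrelated with `X t`, hence, by joint Gaussianity, independent of it as a
  -- family.
  let Z : ι → Ω → ℝ := fun k ω => X (x k) ω - c k * X t ω
  have hind : IndepFun (fun ω (_ : Unit) => X t ω) (fun ω k => Z k ω) P := by
    classical
    refine IsGaussianProcess.indepFun_of_covariance_eq_zero (X := fun (_ : Unit) => X t) (Y := Z)
      ?_ (fun _ => hX.aemeasurable t)
      (fun k => (hX.aemeasurable _).sub ((hX.aemeasurable _).const_mul _)) ?_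
    · refine hX.of_isGaussianProcess ?_
      rintro (_ | k)
      · exact ⟨{t}, ContinuousLinearMap.proj ⟨t, by simp⟩, fun ω => by simp⟩
      · exact ⟨{t, x k}, ContinuousLinearMap.proj ⟨x k, by simp⟩ -
          c k • ContinuousLinearMap.proj ⟨t, by simp⟩, fun ω => by simp [Z]⟩
    · intro _ k
      have : Z k = X (x k) - c k • X t := by ext ω; simp [Z]
      rw [this, covariance_sub_right (hL2 _) (hL2 _) ((hL2 _).const_smul _),
        covariance_smul_right, hcov, hcov, ← hσ2, hcσ, sub_self]
  have hind2 : IndepFun (X t) (fun ω k => Z k ω) P :=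
    hind.comp (φ := fun f : Unit → ℝ => f ()) (ψ := id) (measurable_pi_apply ()) measurable_id
  have hZm : AEMeasurable (fun ω k => Z k ω) P := aemeasurable_pi_lambda _ fun k =>
    (hX.aemeasurable _).sub ((hX.aemeasurable _).const_mul _)
  have hmap := (indepFun_iff_map_prod_eq_prod_map_map (hX.aemeasurable t) hZm).1 hind2
  have hlaw : P.map (X t) = gaussianReal 0 σ2.toNNReal := by
    rw [(hX.hasGaussianLaw_eval t).map_eq_gaussianReal, h0, hvar]
  have hXZ : AEMeasurable (fun ω => (X t ω, fun k => Z k ω)) P := (hX.aemeasurable t).prodMk hZm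
  have hfub : ∀ f : ℝ × (ι → ℝ) → ℝ, Continuous f →
      Integrable (fun ω => f (X t ω, fun k => Z k ω)) P →
      Integrable f ((gaussianReal 0 σ2.toNNReal).prod (P.map fun ω k => Z k ω)) ∧
      ∫ ω, f (X t ω, fun k => Z k ω) ∂P =
        ∫ z, ∫ y, f (y, z) ∂(gaussianReal 0 σ2.toNNReal) ∂(P.map fun ω k => Z k ω) := by
    intro f hf hi
    have h1 : Integrable f (P.map (fun ω => (X t ω, fun k => Z k ω))) :=
      (integrable_map_measure hf.aestronglyMeasurable hXZ).2 hi
    have : IsProbabilityMeasure (P.map fun ω k => Z k ω) := Measure.isProbabilityMeasure_map hZm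
    rw [hmap, hlaw] at h1
    refine ⟨h1, ?_⟩
    rw [← integral_prod_symm _ h1, ← hlaw, ← hmap, integral_map hXZ hf.aestronglyMeasurable]
  have hXe : ∀ s : Finset ι, ∀ ω, ∏ j ∈ s, X (x j) ω = ∏ j ∈ s, (c j * X t ω + Z j ω) := by
    intro s ω
    refine Finset.prod_congr rfl fun j _ => ?_
    simp [Z]
  have hpoly : ∀ (s : Finset ι) (z : ι → ℝ) (y : ℝ),
      (∏ j ∈ s, (Polynomial.C (c j) * Polynomial.X + Polynomial.C (z j))).eval y =
        ∏ j ∈ s, (c j * y + z j) := by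
    intro s z y; simp [Polynomial.eval_prod]
  have hA := hfub (fun q => q.1 * ∏ j, (c j * q.1 + q.2 j)) (by fun_prop) (by
    have := hX.integrable_prod (Finset.univ : Finset (Option ι)) (fun o => o.elim t x)
    refine this.congr (ae_of_all _ fun ω => ?_)
    simp only [Fintype.prod_option, Option.elim]
    rw [hXe])
  have hB := fun k : ι => hfub (fun q => ∏ j ∈ Finset.univ.erase k, (c j * q.1 + q.2 j))
    (by fun_prop) (by
      refine (hX.integrable_prod (Finset.univ.erase k) x).congr (ae_of_all _ fun ω => ?_)
      simp only
      rw [hXe])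
  simp_rw [hXe]
  rw [hA.2]
  have hσc : ((σ2.toNNReal : ℝ≥0) : ℝ) = σ2 := Real.coe_toNNReal _ hσ0
  have : IsProbabilityMeasure (P.map fun ω k => Z k ω) := Measure.isProbabilityMeasure_map hZm
  -- With the residuals frozen, the product is a polynomial in `y`. Stein's identity and the product
  -- rule produce the factor `σ2 * c k`, which is the covariance. The exceptional null set is only
  -- due to integrability of the slices.
  have hstep : ∀ᵐ z ∂(P.map fun ω k => Z k ω),
      ∫ y, y * ∏ j, (c j * y + z j) ∂(gaussianReal 0 σ2.toNNReal) =
      ∑ k, (∫ ω, X t ω * X (x k) ω ∂P) *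
        ∫ y, ∏ j ∈ Finset.univ.erase k, (c j * y + z j) ∂(gaussianReal 0 σ2.toNNReal) := by
    have hae : ∀ᵐ z ∂(P.map fun ω k => Z k ω), ∀ k,
        Integrable (fun y => ∏ j ∈ Finset.univ.erase k, (c j * y + z j))
          (gaussianReal 0 σ2.toNNReal) :=
      ae_all_iff.2 fun k => (hB k).1.prod_left_ae
    filter_upwards [hae] with z hz
    simp_rw [← hpoly]
    rw [integral_mul_eval_gaussianReal, Polynomial.derivative_prod_finset, hσc]
    simp only [Polynomial.eval_finsetSum, Polynomial.eval_mul, hpoly, Polynomial.derivative_add,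
      Polynomial.derivative_C_mul, Polynomial.derivative_X, Polynomial.derivative_C, add_zero,
      mul_one, Polynomial.eval_C]
    rw [integral_finsetSum _ fun k _ => (hz k).mul_const _, Finset.mul_sum]
    refine Finset.sum_congr rfl fun k _ => ?_
    rw [integral_mul_const, ← hcσ]
    ring
  rw [integral_congr_ae hstep, integral_finsetSum]
  · refine Finset.sum_congr rfl fun k _ => ?_
    rw [integral_const_mul, (hB k).2]
  · exact fun k _ => ((hB k).1.integral_prod_right).const_mul _

end Moments

end AverageWave
end

/-! ### Pairing measures and Wick's theorem. -/

noncomputable section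

namespace AverageWave

section PairMeasure

variable {E : Type*} [AddCommGroup E]

/-- Insert `q` in front and `-q` at the position `k` of the remaining vector. -/
def insertPair {N : ℕ} (k : Fin (N + 1)) (w : E × (Fin N → E)) : Fin (N + 2) → E :=
  Fin.cons w.1 (k.insertNth (-w.1) w.2 : Fin (N + 1) → E)

@[simp] lemma insertPair_zero {N : ℕ} (k : Fin (N + 1)) (w : E × (Fin N → E)) :
    insertPair k w 0 = w.1 := rfl

@[simp] lemma insertPair_succ_self {N : ℕ} (k : Fin (N + 1)) (w : E × (Fin N → E)) :
    insertPair k w k.succ = -w.1 := by simp [insertPair]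

@[simp] lemma insertPair_succ_succAbove {N : ℕ} (k : Fin (N + 1)) (w : E × (Fin N → E))
    (j : Fin N) : insertPair k w (k.succAbove j).succ = w.2 j := by simp [insertPair]

lemma sum_insertPair {N : ℕ} {β : Type*} [AddCommMonoid β] (k : Fin (N + 1))
    (w : E × (Fin N → E)) (f : Fin (N + 2) → E → β) :
    ∑ j, f j (insertPair k w j) =
      f 0 w.1 + (f k.succ (-w.1) + ∑ j, f (k.succAbove j).succ (w.2 j)) := by
  rw [Fin.sum_univ_succ, Fin.sum_univ_succAbove _ k]
  simp

lemma prod_insertPair {N : ℕ} {β : Type*} [CommMonoid β] (k : Fin (N + 1))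
    (w : E × (Fin N → E)) (f : Fin (N + 2) → E → β) :
    ∏ j, f j (insertPair k w j) =
      f 0 w.1 * (f k.succ (-w.1) * ∏ j, f (k.succAbove j).succ (w.2 j)) := by
  rw [Fin.prod_univ_succ, Fin.prod_univ_succAbove _ k]
  simp

variable [MeasurableSpace E]

/-- The sum over all pairings of `N` points of the image of the product of copies of `ν`, one for
each pair, under which the two points of a pair carry opposite momenta. -/
def pairMeasure (ν : Measure E) : (N : ℕ) → Measure (Fin N → E)
  | 0 => Measure.dirac 0
  | 1 => 0
  | N + 2 => ∑ k : Fin (N + 1), (ν.prod (pairMeasure ν N)).map (insertPair k)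

variable [MeasurableNeg E]

lemma measurable_insertPair {N : ℕ} (k : Fin (N + 1)) :
    Measurable (insertPair (E := E) k) := by
  refine measurable_pi_iff.2 fun j => ?_
  induction j using Fin.cases with
  | zero => simpa using measurable_fst
  | succ j =>
    rcases Fin.eq_self_or_eq_succAbove k j with rfl | ⟨i, rfl⟩
    · simp only [insertPair_succ_self]
      exact measurable_fst.neg
    · simp only [insertPair_succ_succAbove]
      fun_prop

variable (ν : Measure E)

lemma integral_pairMeasure_add_two {G : Type*} [NormedAddCommGroup G] [NormedSpace ℝ G]
    {N : ℕ} {f : (Fin (N + 2) → E) → G}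
    (hf : Integrable f (pairMeasure ν (N + 2))) :
    ∫ p, f p ∂(pairMeasure ν (N + 2)) =
      ∑ k : Fin (N + 1), ∫ w, f (insertPair k w) ∂(ν.prod (pairMeasure ν N)) := by
  rw [pairMeasure, integrable_finsetSum_measure] at hf
  rw [pairMeasure, integral_finsetSum_measure hf]
  refine Finset.sum_congr rfl fun k hk => ?_
  rw [integral_map (measurable_insertPair k).aemeasurable (hf k hk).aestronglyMeasurable]

variable [IsFiniteMeasure ν]

instance isFiniteMeasure_pairMeasure : ∀ N, IsFiniteMeasure (pairMeasure ν N)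
  | 0 => by unfold pairMeasure; infer_instance
  | 1 => by unfold pairMeasure; infer_instance
  | N + 2 => by
    have := isFiniteMeasure_pairMeasure N
    unfold pairMeasure
    exact ⟨by simp [Measure.finsetSum_apply, measure_lt_top]⟩

lemma real_pairMeasure_add_two (N : ℕ) :
    (pairMeasure ν (N + 2)).real Set.univ =
      (N + 1) * ν.real Set.univ * (pairMeasure ν N).real Set.univ := by
  have h := integral_pairMeasure_add_two ν (N := N) (f := fun _ => (1 : ℝ)) (integrable_const _)
  simp only [integral_const, smul_eq_mul, mul_one, Finset.sum_const, Finset.card_univ,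
    Fintype.card_fin, nsmul_eq_mul] at h
  rw [h, ← Set.univ_prod_univ, measureReal_prod_prod]
  push_cast; ring

/-- For even `N` the mass is `(N-1)!!` times the `N/2`-th power of the mass of `ν`; the induction
step is `(N+1)² ≤ (N+2)(N+1)`. The square root of this bound, against the simplex volume `t^N/N!`,
leaves a summable `1/√N!`. -/
lemma real_pairMeasure_sq_le (N : ℕ) :
    ((pairMeasure ν N).real Set.univ) ^ 2 ≤ ν.real Set.univ ^ N * N.factorial := by
  induction N using Nat.twoStepInduction with
  | zero => simp [pairMeasure]
  | one => simp [pairMeasure]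
  | more N ih _ =>
    rw [real_pairMeasure_add_two, mul_pow, Nat.factorial_succ, Nat.factorial_succ]
    have hM : 0 ≤ ν.real Set.univ := measureReal_nonneg
    calc _ ≤ ((N + 1) * ν.real Set.univ) ^ 2 * (ν.real Set.univ ^ N * N.factorial) := by gcongr
      _ = ((N + 1 : ℝ) * (N + 1)) * (ν.real Set.univ ^ (N + 2) * N.factorial) := by ring
      _ ≤ ((N + 2 : ℝ) * (N + 1)) * (ν.real Set.univ ^ (N + 2) * N.factorial) := by
        gcongr; norm_num
      _ = _ := by push_cast; ring

/-- The version for squared `L²` norms, where a term of order `n` is paired with its conjugate. Each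
step uses `2n+1 ≤ 2(n+1)`. -/
lemma real_pairMeasure_two_mul_le (n : ℕ) :
    (pairMeasure ν (n + n)).real Set.univ ≤ (2 * ν.real Set.univ) ^ n * n.factorial := by
  induction n with
  | zero => simp [pairMeasure]
  | succ n ih =>
    rw [show n + 1 + (n + 1) = n + n + 2 by ring, real_pairMeasure_add_two, Nat.factorial_succ]
    have hM : 0 ≤ ν.real Set.univ := measureReal_nonneg
    calc _ ≤ ((n + n : ℕ) + 1) * ν.real Set.univ *
          ((2 * ν.real Set.univ) ^ n * n.factorial) := by gcongr
      _ ≤ (2 * (n + 1)) * ν.real Set.univ * ((2 * ν.real Set.univ) ^ n * n.factorial) := by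
        gcongr; push_cast; linarith
      _ = _ := by push_cast; ring

/-- The momenta of a pairing add up to zero. -/
lemma sum_eq_zero_ae_pairMeasure [MeasurableSingletonClass E] [MeasurableAdd₂ E] (N : ℕ) :
    ∀ᵐ p ∂(pairMeasure ν N), ∑ j, p j = 0 := by
  have hms : ∀ N, MeasurableSet {p : Fin N → E | ∑ j, p j = 0} := fun N =>
    (Finset.measurable_sum _ fun j _ => measurable_pi_apply j) (measurableSet_singleton 0)
  induction N using Nat.twoStepInduction with
  | zero => simp
  | one => simp [pairMeasure]
  | more N ih _ =>
    rw [pairMeasure, ← Measure.sum_fintype, Measure.ae_sum_iff' (hms _)]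
    intro k
    rw [ae_map_iff (measurable_insertPair k).aemeasurable (hms _)]
    have h := (Measure.quasiMeasurePreserving_snd (μ := ν)).ae ih
    filter_upwards [h] with w hw
    rw [sum_insertPair k w (fun _ p => p), hw]
    simp

/-- Point `0` has `N+1` possible partners, and they all contribute equally because every position
carries the same `g`. This is the moment recursion of a centered Gaussian variable with variance `∫
g(q) g(-q) dν`. -/
lemma integral_prod_pairMeasure_add_two (N : ℕ) {g : E → ℂ} (hg : Measurable g) {C : ℝ}
    (hC : ∀ p, ‖g p‖ ≤ C) :
    ∫ p, ∏ j, g (p j) ∂(pairMeasure ν (N + 2)) =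
      (N + 1) * (∫ q, g q * g (-q) ∂ν) * ∫ p, ∏ j, g (p j) ∂(pairMeasure ν N) := by
  rw [integral_pairMeasure_add_two]
  · simp_rw [fun k w => prod_insertPair (E := E) (N := N) k w (fun _ p => g p), ← mul_assoc]
    rw [Finset.sum_const, integral_prod_mul (fun q => g q * g (-q)) (fun p : Fin N → E => ∏ j, g (p j))]
    simp; ring
  · refine Integrable.of_bound (C := C ^ (N + 2)) ?_ (ae_of_all _ fun p => ?_)
    · exact (Finset.measurable_prod _
        fun j _ => hg.comp (measurable_pi_apply j)).aestronglyMeasurable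
    · rw [norm_prod]
      exact (Finset.prod_le_prod (fun _ _ => norm_nonneg _) fun j _ => hC (p j)).trans (by simp)

end PairMeasure

/-! ### The spectral measure and the moments of the field. -/

section SpectralMeasure

variable {d : ℕ}

/-- The spectral measure of the covariance function `x ↦ ρ(|x|)`: the mixture of the centered
Gaussian laws with covariance `λ² I` under `μ(dλ)`. -/
def spectralMeasure (d : ℕ) (μ : Measure ℝ≥0) : Measure (EuclideanSpace ℝ (Fin d)) :=
  (μ.prod (stdGaussian (EuclideanSpace ℝ (Fin d)))).map fun q => (q.1 : ℝ) • q.2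

variable (μ : Measure ℝ≥0) [IsFiniteMeasure μ]

instance : IsFiniteMeasure (spectralMeasure d μ) := by
  unfold spectralMeasure; infer_instance

/-- The Gaussian law with covariance `λ² I` has characteristic function `exp(-λ²|x|²/2)`; mixing
over `μ(dλ)` gives `ρ`. -/
lemma integral_exp_spectralMeasure (x : EuclideanSpace ℝ (Fin d)) :
    ∫ p, Complex.exp (Complex.I * ((inner ℝ p x : ℝ) : ℂ)) ∂(spectralMeasure d μ) =
      rho μ ((‖x‖ : ℝ) : ℂ) := by
  have hm : Measurable fun q : ℝ≥0 × EuclideanSpace ℝ (Fin d) => (q.1 : ℝ) • q.2 := by fun_prop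
  rw [spectralMeasure, integral_map hm.aemeasurable (by fun_prop), integral_prod, rho]
  · refine integral_congr_ae (ae_of_all _ fun l => ?_)
    have h := charFun_stdGaussian (E := EuclideanSpace ℝ (Fin d)) ((l : ℝ) • x)
    rw [charFun_apply] at h
    simp only
    have h2 : ∀ y : EuclideanSpace ℝ (Fin d),
        Complex.exp (Complex.I * ((inner ℝ ((l : ℝ) • y) x : ℝ) : ℂ)) =
        Complex.exp (((inner ℝ y ((l : ℝ) • x) : ℝ) : ℂ) * Complex.I) := by
      intro y
      rw [inner_smul_left, inner_smul_right, mul_comm]; simp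
    simp_rw [h2]
    rw [h, norm_smul]
    simp
  · refine Integrable.of_bound (C := 1) (by fun_prop) (ae_of_all _ fun w => ?_)
    rw [mul_comm, Complex.norm_exp_ofReal_mul_I]

/-- The mixed moments of the field are Fourier transforms of the pairing measures. -/
lemma integral_prod_eq_integral_pairMeasure {Ω : Type*} [MeasurableSpace Ω] {P : Measure Ω}
    {V : EuclideanSpace ℝ (Fin d) → Ω → ℝ} (hV : IsGaussianProcess V P)
    (hmean : ∀ x, ∫ ω, V x ω ∂P = 0)
    (hcov : ∀ x y, ((∫ ω, V (x + y) ω * V y ω ∂P : ℝ) : ℂ) = rho μ ((‖x‖ : ℝ) : ℂ))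
    (N : ℕ) (x : Fin N → EuclideanSpace ℝ (Fin d)) :
    ((∫ ω, ∏ j, V (x j) ω ∂P : ℝ) : ℂ) =
      ∫ p, Complex.exp (Complex.I * ((∑ j, inner ℝ (p j) (x j) : ℝ) : ℂ))
        ∂(pairMeasure (spectralMeasure d μ) N) := by
  have := hV.isProbabilityMeasure
  induction N using Nat.twoStepInduction with
  | zero => simp [pairMeasure]
  | one => simp [pairMeasure, hmean]
  | more N ih _ =>
    rw [integral_pairMeasure_add_two]
    · simp_rw [Fin.prod_univ_succ (n := N + 1)]
      -- Integration by parts sums over the partner of point `0`, exactly as the recursion defining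
      -- `pairMeasure` does.
      rw [hV.integral_mul_prod hmean]
      push_cast
      refine Finset.sum_congr rfl fun k _ => ?_
      have h1 : ∀ ω, ∏ j ∈ Finset.univ.erase k, V (x j.succ) ω =
          ∏ j, V (x (k.succAbove j).succ) ω := by
        intro ω
        rw [show (Finset.univ.erase k : Finset (Fin (N + 1))) =
          Finset.univ.map k.succAboveEmb by
            ext j; simp [Fin.exists_succAbove_eq_iff], Finset.prod_map]
        rfl
      simp_rw [h1]
      have h2 := ih (fun j => x (k.succAbove j).succ)
      -- The covariance depends on the difference of the two points, so its Fourier representation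
      -- gives them opposite momenta.
      have h3 := hcov (x 0 - x k.succ) (x k.succ)
      rw [sub_add_cancel, ← integral_exp_spectralMeasure] at h3
      push_cast at h2 h3
      rw [h2, h3, ← integral_prod_mul]
      refine integral_congr_ae (ae_of_all _ fun w => ?_)
      simp only
      rw [← Complex.exp_add]
      have := sum_insertPair k w (fun j p => ((inner ℝ p (x j) : ℝ) : ℂ))
      rw [this]
      congr 1
      rw [inner_sub_right, inner_neg_left, Complex.ofReal_sub, Complex.ofReal_neg]
      ring
    · refine Integrable.of_bound (C := 1) ?_ (ae_of_all _ fun w => ?_)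
      · exact Continuous.aestronglyMeasurable (by fun_prop)
      · rw [mul_comm, Complex.norm_exp_ofReal_mul_I]

end SpectralMeasure

end AverageWave
end

/-! ### Bounded approximation by trigonometric polynomials. -/

noncomputable section

namespace AverageWave

section TrigApproximation

variable {d n : ℕ}

lemma continuous_trigSymbol (T : (Fin n → EuclideanSpace ℝ (Fin d)) →₀ ℂ) :
    Continuous (trigSymbol T) := by
  unfold trigSymbol Finsupp.sum
  fun_prop

/-- A continuous periodic function that agrees with the identity on `[-L, L]`. -/
def sawtooth (L : ℝ) (θ : UnitAddCircle) : ℝ :=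
  2 * L / Real.pi * Real.arcsin (AddCircle.toCircle θ : ℂ).im

lemma continuous_sawtooth (L : ℝ) : Continuous (sawtooth L) := by
  unfold sawtooth
  have h : Continuous fun θ : UnitAddCircle => (AddCircle.toCircle θ : ℂ).im :=
    Complex.continuous_im.comp (continuous_subtype_val.comp AddCircle.continuous_toCircle)
  fun_prop

/-- At the circle point `x/(4L)` the imaginary part is `sin(πx/(2L))`, and `|x| ≤ L` is the range
where `arcsin` inverts it. -/
lemma sawtooth_coe {L x : ℝ} (hL : 0 < L) (hx : |x| ≤ L) :
    sawtooth L ((x / (4 * L) : ℝ) : UnitAddCircle) = x := by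
  have h1 : (AddCircle.toCircle ((x / (4 * L) : ℝ) : UnitAddCircle) : ℂ).im =
      Real.sin (Real.pi * x / (2 * L)) := by
    rw [AddCircle.toCircle_apply_mk, Circle.coe_exp, Complex.exp_ofReal_mul_I_im]
    congr 1
    field_simp
    ring
  have h2 := abs_le.1 hx
  have hpi := Real.pi_pos
  rw [sawtooth, h1, Real.arcsin_sin]
  · field_simp
  · rw [le_div_iff₀ (by positivity)]
    nlinarith
  · rw [div_le_iff₀ (by positivity)]
    nlinarith

/-- Folding every coordinate by the sawtooth turns `F` into a continuous function on a torus that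
only takes values of `F` and agrees with `F` on the box. A uniform approximation on the torus is
therefore bounded everywhere, although it is close to `F` only on the box. -/
lemma exists_trigSymbol_near {F : (Fin n → EuclideanSpace ℝ (Fin d)) → ℂ} (hF : Continuous F)
    {C : ℝ} (hC : ∀ p, ‖F p‖ ≤ C) {ε L : ℝ} (hε : 0 < ε) (hL : 0 < L) :
    ∃ T : (Fin n → EuclideanSpace ℝ (Fin d)) →₀ ℂ, (∀ p, ‖trigSymbol T p‖ ≤ C + ε) ∧
      ∀ p, (∀ j i, |p j i| ≤ L) → ‖trigSymbol T p - F p‖ ≤ ε := by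
  let G : C(UnitAddTorus (Fin n × Fin d), ℂ) :=
    ⟨fun θ => F fun j => WithLp.toLp 2 fun i => sawtooth L (θ (j, i)), by
      refine hF.comp (continuous_pi fun j => ?_)
      refine (PiLp.continuous_toLp 2 _).comp (continuous_pi fun i => ?_)
      exact (continuous_sawtooth L).comp (continuous_apply _)⟩
  have hG : G ∈ (Submodule.span ℂ
      (Set.range (UnitAddTorus.mFourier (d := Fin n × Fin d)))).topologicalClosure := by
    rw [UnitAddTorus.span_mFourier_closure_eq_top]; trivial
  obtain ⟨g, hg, hgG⟩ := Metric.mem_closure_iff.1 hG ε hε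
  obtain ⟨c, rfl⟩ := Finsupp.mem_span_range_iff_exists_finsupp.1 hg
  -- The character of index `m` at `p/(4L)` is `exp(2πi m·p/(4L))`, which has frequency `πm/(2L)`.
  let freq : ((Fin n × Fin d) → ℤ) → Fin n → EuclideanSpace ℝ (Fin d) :=
    fun m j => WithLp.toLp 2 fun i => Real.pi * m (j, i) / (2 * L)
  let pt : (Fin n → EuclideanSpace ℝ (Fin d)) → UnitAddTorus (Fin n × Fin d) :=
    fun p ji => ((p ji.1 ji.2 / (4 * L) : ℝ) : UnitAddCircle)
  have hT : ∀ p, trigSymbol (c.mapDomain freq) p =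
      (c.sum fun i a => a • UnitAddTorus.mFourier i) (pt p) := by
    intro p
    rw [trigSymbol, Finsupp.sum_mapDomain_index (by simp) (by intros; ring)]
    simp only [Finsupp.sum, ContinuousMap.coe_sum, Finset.sum_apply, ContinuousMap.coe_smul,
      Pi.smul_apply, smul_eq_mul]
    refine Finset.sum_congr rfl fun m _ => ?_
    congr 1
    simp only [UnitAddTorus.mFourier, ContinuousMap.coe_mk, pt, fourier_coe_apply]
    rw [← Complex.exp_sum, Fintype.sum_prod_type]
    congr 1
    rw [Complex.ofReal_sum, Finset.mul_sum]
    refine Finset.sum_congr rfl fun j _ => ?_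
    rw [PiLp.inner_apply, Complex.ofReal_sum, Finset.mul_sum]
    refine Finset.sum_congr rfl fun i _ => ?_
    have : (L : ℂ) ≠ 0 := by exact_mod_cast hL.ne'
    simp [freq]
    field_simp
    ring
  have hdist : ∀ p, ‖trigSymbol (c.mapDomain freq) p - G (pt p)‖ ≤ ε := by
    intro p
    rw [hT, ← dist_eq_norm, dist_comm]
    exact (ContinuousMap.dist_apply_le_dist _).trans hgG.le
  refine ⟨c.mapDomain freq, fun p => ?_, fun p hp => ?_⟩
  · calc _ = ‖G (pt p) + (trigSymbol (c.mapDomain freq) p - G (pt p))‖ := by congr 1; ring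
      _ ≤ _ := (norm_add_le _ _).trans (add_le_add (hC _) (hdist p))
  · have : G (pt p) = F p := by
      simp only [G, pt, ContinuousMap.coe_mk]
      congr 1
      ext j i
      exact sawtooth_coe hL (hp j i)
    rw [← this]
    exact hdist p

/-- A bounded continuous function is the pointwise limit of a uniformly bounded sequence of
trigonometric polynomials. -/
lemma exists_tendsto_trigSymbol {F : (Fin n → EuclideanSpace ℝ (Fin d)) → ℂ} (hF : Continuous F)
    {C : ℝ} (hC : ∀ p, ‖F p‖ ≤ C) :
    ∃ T : ℕ → ((Fin n → EuclideanSpace ℝ (Fin d)) →₀ ℂ),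
      (∀ k p, ‖trigSymbol (T k) p‖ ≤ C + 1) ∧
      ∀ p, Tendsto (fun k => trigSymbol (T k) p) atTop (𝓝 (F p)) := by
  -- The error shrinks while the box grows, so each fixed `p` eventually lies in the box.
  have h := fun k : ℕ => exists_trigSymbol_near hF hC (ε := 1 / ((k : ℝ) + 1)) (L := (k : ℝ) + 1)
    (by positivity) (by positivity)
  choose T hT1 hT2 using h
  refine ⟨T, fun k p => (hT1 k p).trans ?_, fun p => ?_⟩
  · gcongr
    rw [div_le_one (by positivity)]
    linarith [(Nat.cast_nonneg k : (0 : ℝ) ≤ k)]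
  · rw [tendsto_iff_norm_sub_tendsto_zero]
    refine squeeze_zero' (Eventually.of_forall fun _ => norm_nonneg _) ?_
      tendsto_one_div_add_atTop_nhds_zero_nat
    obtain ⟨N, hN⟩ := exists_nat_ge ‖p‖
    filter_upwards [eventually_ge_atTop N] with k hk
    refine hT2 k p fun j i => ?_
    have h1 : |p j i| ≤ ‖p j‖ := PiLp.norm_apply_le (p j) i
    have h2 := norm_le_pi_norm p j
    have h3 : (N : ℝ) ≤ k := by exact_mod_cast hk
    linarith

end TrigApproximation

end AverageWave
end

/-! ### Spectral integrals in `L²`. -/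

noncomputable section

namespace AverageWave

open ComplexConjugate

/-- A centered Gaussian field with covariance `x ↦ ρ(|x|)`. -/
structure IsSpectralField {d : ℕ} {Ω : Type*} [MeasurableSpace Ω] (μ : Measure ℝ≥0)
    (V : EuclideanSpace ℝ (Fin d) → Ω → ℝ) (P : Measure Ω) : Prop where
  gaussian : IsGaussianProcess V P
  mean : ∀ x, ∫ ω, V x ω ∂P = 0
  cov : ∀ x y, ((∫ ω, V (x + y) ω * V y ω ∂P : ℝ) : ℂ) = rho μ ((‖x‖ : ℝ) : ℂ)

/-- The pairing measure of the spectral measure of the field. -/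
abbrev momentMeasure (d : ℕ) (μ : Measure ℝ≥0) (N : ℕ) :
    Measure (Fin N → EuclideanSpace ℝ (Fin d)) :=
  pairMeasure (spectralMeasure d μ) N

variable {d n m : ℕ} {Ω : Type*} [MeasurableSpace Ω] {μ : Measure ℝ≥0} [IsFiniteMeasure μ]
  {V : EuclideanSpace ℝ (Fin d) → Ω → ℝ} {P : Measure Ω}

lemma memLp_trigEval (hV : IsGaussianProcess V P)
    (T : (Fin n → EuclideanSpace ℝ (Fin d)) →₀ ℂ) : MemLp (trigEval V T) 2 P := by
  unfold trigEval Finsupp.sum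
  refine memLp_finsetSum _ fun x _ => MemLp.const_mul ?_ _
  have h := (hV.memLp_prod Finset.univ x (p := 2) (by simp)).ofReal (K := ℂ)
  simpa using h

/-- The class in `L²` of the integral of a trigonometric polynomial. -/
def trigLp (hV : IsGaussianProcess V P) (T : (Fin n → EuclideanSpace ℝ (Fin d)) →₀ ℂ) :
    Lp ℂ 2 P := (memLp_trigEval hV T).toLp (trigEval V T)

lemma isSpectralIntegral_iff (hV : IsGaussianProcess V P)
    {F : (Fin n → EuclideanSpace ℝ (Fin d)) → ℂ} {J : Lp ℂ 2 P} :
    IsSpectralIntegral V P F J ↔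
      ∃ T : ℕ → ((Fin n → EuclideanSpace ℝ (Fin d)) →₀ ℂ),
        (∃ C : ℝ, ∀ k p, ‖trigSymbol (T k) p‖ ≤ C) ∧
        (∀ p, Tendsto (fun k => trigSymbol (T k) p) atTop (𝓝 (F p))) ∧
        Tendsto (fun k => trigLp hV (T k)) atTop (𝓝 J) := by
  have h : ∀ T : ℕ → ((Fin n → EuclideanSpace ℝ (Fin d)) →₀ ℂ),
      Tendsto (fun k => trigLp hV (T k)) atTop (𝓝 J) ↔
      Tendsto (fun k => eLpNorm (fun ω => trigEval V (T k) ω - J ω) 2 P) atTop (𝓝 0) := by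
    intro T
    have := Lp.tendsto_Lp_iff_tendsto_eLpNorm'' (fi := atTop) (fun k => trigEval V (T k))
      (fun k => memLp_trigEval hV (T k)) J (Lp.memLp J)
    rw [Lp.toLp_coeFn] at this
    exact this
  simp_rw [h]
  rfl

lemma trigSymbol_sub (T T' : (Fin n → EuclideanSpace ℝ (Fin d)) →₀ ℂ)
    (p : Fin n → EuclideanSpace ℝ (Fin d)) :
    trigSymbol (T - T') p = trigSymbol T p - trigSymbol T' p := by
  unfold trigSymbol
  exact Finsupp.sum_sub_index (by intros; ring)

lemma trigLp_sub (hV : IsGaussianProcess V P)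
    (T T' : (Fin n → EuclideanSpace ℝ (Fin d)) →₀ ℂ) :
    trigLp hV (T - T') = trigLp hV T - trigLp hV T' := by
  unfold trigLp
  rw [← MemLp.toLp_sub]
  congr 1
  ext ω
  simp only [trigEval, Pi.sub_apply]
  exact Finsupp.sum_sub_index (by intros; ring)

/-- The sesquilinear symbol of the `L²` inner product of two spectral integrals. -/
def pairSymbol (F : (Fin n → EuclideanSpace ℝ (Fin d)) → ℂ)
    (G : (Fin m → EuclideanSpace ℝ (Fin d)) → ℂ) (p : Fin (n + m) → EuclideanSpace ℝ (Fin d)) :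
    ℂ :=
  F (fun j => p (Fin.castAdd m j)) * conj (G fun j => -p (Fin.natAdd n j))

lemma norm_pairSymbol_le {F : (Fin n → EuclideanSpace ℝ (Fin d)) → ℂ}
    {G : (Fin m → EuclideanSpace ℝ (Fin d)) → ℂ} {C C' : ℝ} (hF : ∀ p, ‖F p‖ ≤ C)
    (hG : ∀ p, ‖G p‖ ≤ C') (p : Fin (n + m) → EuclideanSpace ℝ (Fin d)) :
    ‖pairSymbol F G p‖ ≤ C * C' := by
  rw [pairSymbol, norm_mul, RCLike.norm_conj]
  exact mul_le_mul (hF _) (hG _) (norm_nonneg _) ((norm_nonneg _).trans (hF 0))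

lemma continuous_pairSymbol {F : (Fin n → EuclideanSpace ℝ (Fin d)) → ℂ}
    {G : (Fin m → EuclideanSpace ℝ (Fin d)) → ℂ} (hF : Continuous F) (hG : Continuous G) :
    Continuous (pairSymbol F G) := by
  unfold pairSymbol
  exact (hF.comp (by fun_prop)).mul (Complex.continuous_conj.comp (hG.comp (by fun_prop)))

/-- The moment formula is applied to the concatenated points `Fin.append x y`. As `V` is real,
conjugation acts only on coefficients, and `conj(exp(-ip·y)) = exp(ip·y)` explains the reflected
momenta in `pairSymbol`. -/
lemma inner_trigLp (hV : IsSpectralField μ V P) (T : (Fin n → EuclideanSpace ℝ (Fin d)) →₀ ℂ)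
    (T' : (Fin m → EuclideanSpace ℝ (Fin d)) →₀ ℂ) :
    inner ℂ (trigLp hV.gaussian T') (trigLp hV.gaussian T) =
      ∫ p, pairSymbol (trigSymbol T) (trigSymbol T') p ∂(momentMeasure d μ (n + m)) := by
  have h1 : inner ℂ (trigLp hV.gaussian T') (trigLp hV.gaussian T) =
      ∫ ω, ∑ x ∈ T.support, ∑ y ∈ T'.support,
        (T x * conj (T' y)) * ((∏ j, V (Fin.append x y j) ω : ℝ) : ℂ) ∂P := by
    rw [L2.inner_def]
    refine integral_congr_ae ?_
    filter_upwards [(memLp_trigEval hV.gaussian T).coeFn_toLp,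
      (memLp_trigEval hV.gaussian T').coeFn_toLp] with ω h1 h2
    rw [trigLp, trigLp, h1, h2, RCLike.inner_apply, trigEval, trigEval, Finsupp.sum, Finsupp.sum,
      map_sum, Finset.sum_mul_sum]
    refine Finset.sum_congr rfl fun x _ => Finset.sum_congr rfl fun y _ => ?_
    rw [Fin.prod_univ_add]
    simp only [Fin.append_left, Fin.append_right, map_mul, map_prod, Complex.conj_ofReal]
    push_cast
    ring
  have h2 : ∀ p : Fin (n + m) → EuclideanSpace ℝ (Fin d),
      pairSymbol (trigSymbol T) (trigSymbol T') p = ∑ x ∈ T.support, ∑ y ∈ T'.support,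
        (T x * conj (T' y)) *
          Complex.exp (Complex.I * ((∑ j, inner ℝ (p j) (Fin.append x y j) : ℝ) : ℂ)) := by
    intro p
    rw [pairSymbol, trigSymbol, trigSymbol, Finsupp.sum, Finsupp.sum, map_sum, Finset.sum_mul_sum]
    refine Finset.sum_congr rfl fun x _ => Finset.sum_congr rfl fun y _ => ?_
    rw [Fin.sum_univ_add, map_mul, ← Complex.exp_conj]
    simp only [Fin.append_left, Fin.append_right, map_mul, Complex.conj_I, Complex.conj_ofReal,
      inner_neg_left, Finset.sum_neg_distrib]
    rw [Complex.ofReal_add, mul_add, Complex.exp_add, Complex.ofReal_neg]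
    ring_nf
  have hi1 : ∀ z : Fin (n + m) → EuclideanSpace ℝ (Fin d),
      Integrable (fun ω => ((∏ j, V (z j) ω : ℝ) : ℂ)) P :=
    fun z => (hV.gaussian.integrable_prod Finset.univ z).ofReal
  have hi2 : ∀ z : Fin (n + m) → EuclideanSpace ℝ (Fin d),
      Integrable (fun p : Fin (n + m) → EuclideanSpace ℝ (Fin d) =>
        Complex.exp (Complex.I * ((∑ j, inner ℝ (p j) (z j) : ℝ) : ℂ)))
        (momentMeasure d μ (n + m)) := fun z => by
    refine Integrable.of_bound (C := 1) (Continuous.aestronglyMeasurable (by fun_prop))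
      (ae_of_all _ fun w => ?_)
    rw [mul_comm, Complex.norm_exp_ofReal_mul_I]
  simp_rw [h1, h2]
  rw [integral_finsetSum _ fun x _ => integrable_finsetSum _ fun y _ => (hi1 _).const_mul _,
    integral_finsetSum _ fun x _ => integrable_finsetSum _ fun y _ => (hi2 _).const_mul _]
  refine Finset.sum_congr rfl fun x _ => ?_
  rw [integral_finsetSum _ fun y _ => (hi1 _).const_mul _,
    integral_finsetSum _ fun y _ => (hi2 _).const_mul _]
  refine Finset.sum_congr rfl fun y _ => ?_
  rw [integral_const_mul, integral_const_mul,
    ← integral_prod_eq_integral_pairMeasure μ hV.gaussian hV.mean hV.cov, integral_complex_ofReal]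

/-- Dominated convergence on a finite measure. The filter is general because both sequences and the
double index of a Cauchy criterion are needed. -/
lemma tendsto_integral_pairSymbol {κ : Type*} {l : Filter κ} [l.IsCountablyGenerated]
    {T : κ → ((Fin n → EuclideanSpace ℝ (Fin d)) →₀ ℂ)}
    {T' : κ → ((Fin m → EuclideanSpace ℝ (Fin d)) →₀ ℂ)}
    {F : (Fin n → EuclideanSpace ℝ (Fin d)) → ℂ} {G : (Fin m → EuclideanSpace ℝ (Fin d)) → ℂ}
    {C C' : ℝ} (hT : ∀ k p, ‖trigSymbol (T k) p‖ ≤ C) (hT' : ∀ k p, ‖trigSymbol (T' k) p‖ ≤ C')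
    (hF : ∀ p, Tendsto (fun k => trigSymbol (T k) p) l (𝓝 (F p)))
    (hG : ∀ p, Tendsto (fun k => trigSymbol (T' k) p) l (𝓝 (G p))) :
    Tendsto (fun k => ∫ p, pairSymbol (trigSymbol (T k)) (trigSymbol (T' k)) p
      ∂(momentMeasure d μ (n + m))) l (𝓝 (∫ p, pairSymbol F G p ∂(momentMeasure d μ (n + m)))) := by
  refine tendsto_integral_filter_of_dominated_convergence (fun _ => C * C')
    (Eventually.of_forall fun k =>
      (continuous_pairSymbol (continuous_trigSymbol _)
        (continuous_trigSymbol _)).aestronglyMeasurable)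
    (Eventually.of_forall fun k => ae_of_all _ (norm_pairSymbol_le (hT k) (hT' k)))
    (integrable_const _) (ae_of_all _ fun p => ?_)
  exact (hF _).mul ((Complex.continuous_conj.tendsto _).comp (hG _))

/-- The isometry property of spectral integrals. -/
lemma IsSpectralIntegral.inner_eq (hV : IsSpectralField μ V P)
    {F : (Fin n → EuclideanSpace ℝ (Fin d)) → ℂ} {G : (Fin m → EuclideanSpace ℝ (Fin d)) → ℂ}
    {J K : Lp ℂ 2 P} (hJ : IsSpectralIntegral V P F J) (hK : IsSpectralIntegral V P G K) :
    inner ℂ K J = ∫ p, pairSymbol F G p ∂(momentMeasure d μ (n + m)) := by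
  obtain ⟨T, ⟨C, hC⟩, hF, hJ⟩ := (isSpectralIntegral_iff hV.gaussian).1 hJ
  obtain ⟨T', ⟨C', hC'⟩, hG, hK⟩ := (isSpectralIntegral_iff hV.gaussian).1 hK
  have h := hK.inner (𝕜 := ℂ) hJ
  simp_rw [inner_trigLp hV] at h
  exact tendsto_nhds_unique h (tendsto_integral_pairSymbol hC hC' hF hG)

lemma IsSpectralIntegral.sub (hV : IsSpectralField μ V P)
    {F G : (Fin n → EuclideanSpace ℝ (Fin d)) → ℂ} {J K : Lp ℂ 2 P}
    (hJ : IsSpectralIntegral V P F J) (hK : IsSpectralIntegral V P G K) :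
    IsSpectralIntegral V P (F - G) (J - K) := by
  obtain ⟨T, ⟨C, hC⟩, hF, hJ⟩ := (isSpectralIntegral_iff hV.gaussian).1 hJ
  obtain ⟨T', ⟨C', hC'⟩, hG, hK⟩ := (isSpectralIntegral_iff hV.gaussian).1 hK
  refine (isSpectralIntegral_iff hV.gaussian).2 ⟨fun k => T k - T' k, ⟨C + C', fun k p => ?_⟩,
    fun p => ?_, ?_⟩
  · rw [trigSymbol_sub]
    exact (norm_sub_le _ _).trans (add_le_add (hC k p) (hC' k p))
  · simp_rw [trigSymbol_sub]
    exact (hF p).sub (hG p)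
  · simp_rw [trigLp_sub]
    exact hJ.sub hK

lemma IsSpectralIntegral.norm_sq_eq (hV : IsSpectralField μ V P)
    {F : (Fin n → EuclideanSpace ℝ (Fin d)) → ℂ} {J : Lp ℂ 2 P}
    (hJ : IsSpectralIntegral V P F J) :
    ((‖J‖ ^ 2 : ℝ) : ℂ) = ∫ p, pairSymbol F F p ∂(momentMeasure d μ (n + n)) := by
  rw [← hJ.inner_eq hV hJ, inner_self_eq_norm_sq_to_K]
  simp

/-- Spectral integrals are unique. -/
lemma IsSpectralIntegral.unique (hV : IsSpectralField μ V P)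
    {F : (Fin n → EuclideanSpace ℝ (Fin d)) → ℂ} {J K : Lp ℂ 2 P}
    (hJ : IsSpectralIntegral V P F J) (hK : IsSpectralIntegral V P F K) : J = K := by
  have h := (hJ.sub hV hK).norm_sq_eq hV
  simp only [sub_self, pairSymbol, Pi.zero_apply, zero_mul, integral_zero] at h
  rw [← sub_eq_zero, ← norm_eq_zero]
  exact pow_eq_zero_iff (two_ne_zero) |>.1 (by exact_mod_cast h)

lemma IsSpectralIntegral.norm_le (hV : IsSpectralField μ V P)
    {F : (Fin n → EuclideanSpace ℝ (Fin d)) → ℂ} {J : Lp ℂ 2 P}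
    (hJ : IsSpectralIntegral V P F J) {C : ℝ} (hC : ∀ p, ‖F p‖ ≤ C) :
    ‖J‖ ^ 2 ≤ C ^ 2 * (momentMeasure d μ (n + n)).real Set.univ := by
  have h := congrArg norm (hJ.norm_sq_eq hV)
  rw [Complex.norm_real, Real.norm_of_nonneg (by positivity)] at h
  rw [h]
  refine (norm_integral_le_of_norm_le_const (C := C ^ 2) (ae_of_all _ fun p => ?_))
  rw [sq]
  exact norm_pairSymbol_le hC hC p

/-- Bounded continuous functions have spectral integrals. -/
lemma exists_isSpectralIntegral (hV : IsSpectralField μ V P)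
    {F : (Fin n → EuclideanSpace ℝ (Fin d)) → ℂ} (hF : Continuous F) {C : ℝ}
    (hC : ∀ p, ‖F p‖ ≤ C) : ∃ J : Lp ℂ 2 P, IsSpectralIntegral V P F J := by
  obtain ⟨T, hT, hTF⟩ := exists_tendsto_trigSymbol hF hC
  -- The symbols of the differences are uniformly bounded and tend to zero pointwise, so their `L²`
  -- norms tend to zero by the pairing formula.
  have hcau : CauchySeq fun k => trigLp hV.gaussian (T k) := by
    rw [cauchySeq_iff_tendsto_dist_atTop_0]
    have hbd : ∀ (k : ℕ × ℕ) p, ‖trigSymbol (T k.1 - T k.2) p‖ ≤ (C + 1) + (C + 1) := by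
      intro k p
      rw [trigSymbol_sub]
      exact (norm_sub_le _ _).trans (add_le_add (hT _ _) (hT _ _))
    have hlim : ∀ p, Tendsto (fun k : ℕ × ℕ => trigSymbol (T k.1 - T k.2) p) atTop
        (𝓝 ((0 : (Fin n → EuclideanSpace ℝ (Fin d)) → ℂ) p)) := by
      intro p
      simp_rw [trigSymbol_sub]
      rw [← prod_atTop_atTop_eq]
      have := ((hTF p).comp (tendsto_fst (f := (atTop : Filter ℕ)) (g := (atTop : Filter ℕ)))).sub
        ((hTF p).comp (tendsto_snd (f := (atTop : Filter ℕ)) (g := (atTop : Filter ℕ))))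
      simpa [Function.comp_def] using this
    have h := tendsto_integral_pairSymbol (μ := μ) hbd hbd hlim hlim
    simp_rw [← inner_trigLp hV] at h
    simp only [pairSymbol, Pi.zero_apply, zero_mul, integral_zero] at h
    have h2 := (continuous_norm.tendsto _).comp h
    rw [norm_zero] at h2
    have h3 := (Real.continuous_sqrt.tendsto _).comp h2
    rw [Real.sqrt_zero] at h3
    refine h3.congr fun k => ?_
    simp only [Function.comp]
    rw [inner_self_eq_norm_sq_to_K, dist_eq_norm, trigLp_sub]
    simp
  obtain ⟨J, hJ⟩ := cauchySeq_tendsto_of_complete hcau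
  exact ⟨J, (isSpectralIntegral_iff hV.gaussian).2 ⟨T, ⟨_, hT⟩, hTF, hJ⟩⟩

/-- The constant `1` is a spectral integral of order zero. Expectations thereby become inner
products, covered by the isometry formula. -/
lemma isSpectralIntegral_one [IsProbabilityMeasure P] :
    IsSpectralIntegral V P (fun _ : Fin 0 → EuclideanSpace ℝ (Fin d) => 1)
      (indicatorConstLp 2 MeasurableSet.univ (measure_ne_top P _) (1 : ℂ)) := by
  refine ⟨fun _ => Finsupp.single 0 1, ⟨1, fun k p => ?_⟩, fun p => ?_, ?_⟩
  · simp [trigSymbol]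
  · simp [trigSymbol]
  · refine tendsto_const_nhds.congr fun k => Eq.symm ?_
    rw [← eLpNorm_zero (μ := P) (p := 2) (ε := ℂ)]
    refine eLpNorm_congr_ae ?_
    filter_upwards [indicatorConstLp_coeFn (p := 2) (hs := MeasurableSet.univ)
      (hμs := measure_ne_top P _) (c := (1 : ℂ))] with ω hω
    rw [hω]
    simp [trigEval]

/-- The expectation of a spectral integral. -/
lemma IsSpectralIntegral.integral_eq [IsProbabilityMeasure P] (hV : IsSpectralField μ V P)
    {F : (Fin n → EuclideanSpace ℝ (Fin d)) → ℂ} {J : Lp ℂ 2 P}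
    (hJ : IsSpectralIntegral V P F J) :
    ∫ ω, J ω ∂P = ∫ p, F p ∂(momentMeasure d μ n) := by
  have h := hJ.inner_eq hV isSpectralIntegral_one
  rw [L2.inner_indicatorConstLp_one, Measure.restrict_univ] at h
  rw [h]
  refine integral_congr_ae (ae_of_all _ fun p => ?_)
  simp [pairSymbol]

end AverageWave
end

/-! ### The ordered simplex and the cube. -/

noncomputable section

namespace AverageWave

section Simplex

/-- The cube `[0, t]^n`. -/
def timeCube (n : ℕ) (t : ℝ) : Set (Fin n → ℝ) := Set.univ.pi fun _ => Set.Icc 0 t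

variable {n : ℕ} {t : ℝ}

lemma mem_timeSimplex_iff {s : Fin n → ℝ} :
    s ∈ timeSimplex n t ↔ Antitone s ∧ s ∈ timeCube n t := by
  simp only [timeSimplex, timeCube, Set.mem_ofPred_eq, Set.mem_univ_pi, Set.mem_Icc]

lemma isCompact_timeCube : IsCompact (timeCube n t) :=
  isCompact_univ_pi fun _ => isCompact_Icc

lemma measurableSet_timeCube : MeasurableSet (timeCube n t) :=
  isCompact_timeCube.measurableSet

lemma isCompact_timeSimplex : IsCompact (timeSimplex n t) := by
  have : timeSimplex n t = timeCube n t ∩ {s | Antitone s} := by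
    ext s; rw [mem_timeSimplex_iff, and_comm]; rfl
  rw [this]
  refine isCompact_timeCube.inter_right ?_
  have : {s : Fin n → ℝ | Antitone s} = ⋂ (i : Fin n) (j : Fin n) (_ : i ≤ j), {s | s j ≤ s i} := by
    ext s; simp [Antitone]
  rw [this]
  exact isClosed_iInter fun i => isClosed_iInter fun j => isClosed_iInter fun _ =>
    isClosed_le (continuous_apply j) (continuous_apply i)

lemma measurableSet_timeSimplex : MeasurableSet (timeSimplex n t) :=
  isCompact_timeSimplex.measurableSet

/-- Coincidence of two coordinates defines a proper subspace, a null set. Off these sets a unique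
permutation puts the times in order. -/
lemma ae_injective : ∀ᵐ s : Fin n → ℝ, Function.Injective s := by
  have h : ∀ i j : Fin n, ∀ᵐ s : Fin n → ℝ, s i = s j → i = j := by
    intro i j
    rcases eq_or_ne i j with hij | hij
    · exact ae_of_all _ fun _ _ => hij
    let L : (Fin n → ℝ) →ₗ[ℝ] ℝ := (LinearMap.proj i : (Fin n → ℝ) →ₗ[ℝ] ℝ) - LinearMap.proj j
    have hL : LinearMap.ker L ≠ ⊤ := by
      intro h
      have : L (Pi.single i 1) = 0 := by
        rw [← LinearMap.mem_ker, h]; trivial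
      simp [L, hij.symm] at this
    have h0 := Measure.addHaar_submodule (volume : Measure (Fin n → ℝ)) _ hL
    filter_upwards [measure_eq_zero_iff_ae_notMem.1 h0] with s hs hsij
    exact absurd (by simp [L, hsij]) hs
  filter_upwards [ae_all_iff.2 fun i => ae_all_iff.2 (h i)] with s hs i j
  exact hs i j

lemma existsUnique_perm_antitone {s : Fin n → ℝ} (hs : Function.Injective s) :
    ∃! σ : Equiv.Perm (Fin n), Antitone (s ∘ σ) := by
  refine ⟨Tuple.sort fun i => -s i, fun i j hij => ?_, fun σ hσ => ?_⟩
  · exact neg_le_neg_iff.1 (Tuple.monotone_sort (fun i => -s i) hij)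
  · have hτ : Antitone (s ∘ Tuple.sort fun i => -s i) := fun i j hij =>
      neg_le_neg_iff.1 (Tuple.monotone_sort (fun i => -s i) hij)
    -- A strictly monotone family on `Fin n` is determined by its range, and all rearrangements of
    -- `s` have the same range.
    have key : ∀ π : Equiv.Perm (Fin n), Antitone (s ∘ π) →
        StrictMono fun i => -(s (π i)) := by
      intro π hπ
      refine Monotone.strictMono_of_injective (fun i j hij => neg_le_neg (hπ hij)) ?_
      exact neg_injective.comp (hs.comp π.injective)
    have hr : ∀ π : Equiv.Perm (Fin n), Set.range (fun i => -(s (π i))) =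
        Set.range fun i => -(s i) :=
      fun π => π.surjective.range_comp fun i => -(s i)
    have h := ((key σ hσ).range_inj (key _ hτ)).1 ((hr σ).trans (hr _).symm)
    exact Equiv.ext fun i => hs (neg_injective (congrFun h i))

/-- The coordinates of `ℝ^n` may be permuted under the integral. -/
lemma measurePreserving_comp_perm (σ : Equiv.Perm (Fin n)) :
    MeasurePreserving (fun s : Fin n → ℝ => s ∘ σ) := by
  have h := volume_measurePreserving_piCongrLeft (fun _ : Fin n => ℝ) σ.symm
  have hfun : (fun s : Fin n → ℝ => s ∘ σ) =
      MeasurableEquiv.piCongrLeft (fun _ : Fin n => ℝ) σ.symm := by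
    funext s i
    obtain ⟨j, rfl⟩ := σ.symm.surjective i
    rw [MeasurableEquiv.coe_piCongrLeft, Equiv.piCongrLeft_apply_apply]
    simp
  rw [hfun]
  exact h

/-- The integral of a symmetric function over the cube is `n!` times its integral over the
ordered simplex. -/
lemma integral_timeCube_eq {f : (Fin n → ℝ) → ℂ} (hf : IntegrableOn f (timeCube n t))
    (hsymm : ∀ (σ : Equiv.Perm (Fin n)) s, f (s ∘ σ) = f s) :
    ∫ s in timeCube n t, f s = n.factorial * ∫ s in timeSimplex n t, f s := by
  have hmem : ∀ (σ : Equiv.Perm (Fin n)) (s : Fin n → ℝ),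
      s ∘ σ ∈ timeCube n t ↔ s ∈ timeCube n t := by
    intro σ s
    simp only [timeCube, Set.mem_univ_pi, Function.comp_apply]
    exact ⟨fun h i => by simpa using h (σ.symm i), fun h i => h _⟩
  set g : (Fin n → ℝ) → ℂ := (timeSimplex n t).indicator f with hg
  have hgi : Integrable g := (hf.mono_set fun s hs => (mem_timeSimplex_iff.1 hs).2).integrable_indicator
    measurableSet_timeSimplex
  -- Almost every point of the cube lies in exactly one permuted copy of the simplex.
  have h1 : (timeCube n t).indicator f =ᵐ[volume]
      fun s => ∑ σ : Equiv.Perm (Fin n), g (s ∘ σ) := by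
    filter_upwards [ae_injective] with s hs
    obtain ⟨σ, hσ, huniq⟩ := existsUnique_perm_antitone hs
    rw [Finset.sum_eq_single σ]
    · by_cases hc : s ∈ timeCube n t
      · rw [Set.indicator_of_mem hc, hg, Set.indicator_of_mem, hsymm]
        exact mem_timeSimplex_iff.2 ⟨hσ, (hmem σ s).2 hc⟩
      · rw [Set.indicator_of_notMem hc, hg, Set.indicator_of_notMem]
        exact fun h => hc ((hmem σ s).1 (mem_timeSimplex_iff.1 h).2)
    · intro τ _ hτ
      rw [hg, Set.indicator_of_notMem]
      exact fun h => hτ (huniq τ (mem_timeSimplex_iff.1 h).1)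
    · simp
  rw [← integral_indicator measurableSet_timeCube, integral_congr_ae h1, integral_finsetSum]
  · have h2 : ∀ σ : Equiv.Perm (Fin n), ∫ s, g (s ∘ σ) = ∫ s, g s := by
      intro σ
      have hmp := measurePreserving_comp_perm σ
      rw [← integral_map (φ := fun s : Fin n → ℝ => s ∘ σ) hmp.measurable.aemeasurable
        (by rw [hmp.map_eq]; exact hgi.aestronglyMeasurable), hmp.map_eq]
    simp_rw [h2]
    rw [Finset.sum_const, Finset.card_univ, Fintype.card_perm, Fintype.card_fin, nsmul_eq_mul,
      hg, integral_indicator measurableSet_timeSimplex]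
  · intro σ _
    exact (measurePreserving_comp_perm σ).integrable_comp_of_integrable hgi

lemma volume_real_timeSimplex (ht : 0 ≤ t) :
    volume.real (timeSimplex n t) = t ^ n / n.factorial := by
  have h := integral_timeCube_eq (n := n) (t := t) (f := fun _ => 1)
    (integrableOn_const isCompact_timeCube.measure_lt_top.ne) (by simp)
  simp only [integral_const, MeasurableSet.univ, measureReal_restrict_apply, Set.univ_inter,
    Complex.real_smul, mul_one] at h
  have hc : volume.real (timeCube n t) = t ^ n := by
    rw [Measure.real, timeCube, volume_pi_pi]
    simp [ht]
  rw [hc] at h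
  have h' : t ^ n = n.factorial * volume.real (timeSimplex n t) := by exact_mod_cast h
  rw [h']
  field_simp

end Simplex

/-- The square of the term is the product of `(2x²)^n/n!` and `2^{-n}`, so the term is at most their
sum; both are summable. -/
lemma summable_pow_div_sqrt_factorial (x : ℝ) :
    Summable fun n : ℕ => x ^ n / √(n.factorial : ℝ) := by
  refine Summable.of_norm_bounded (g := fun n : ℕ =>
    (2 * x ^ 2) ^ n / n.factorial + (1 / 2 : ℝ) ^ n)
    ((Real.summable_pow_div_factorial _).add
      (summable_geometric_of_lt_one (by norm_num) (by norm_num))) fun n => ?_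
  rw [Real.norm_eq_abs]
  have h1 : (2 * x ^ 2) ^ n / n.factorial * (1 / 2 : ℝ) ^ n = (x ^ n / √(n.factorial : ℝ)) ^ 2 := by
    rw [div_pow (x ^ n), Real.sq_sqrt (by positivity), mul_pow, div_mul_eq_mul_div, one_div, inv_pow]
    have : (2 : ℝ) ^ n ≠ 0 := by positivity
    field_simp
    ring
  refine abs_le_of_sq_le_sq ?_ (by positivity)
  rw [← h1]
  have ha : 0 ≤ (2 * x ^ 2) ^ n / n.factorial := by positivity
  have hb : (0 : ℝ) ≤ (1 / 2 : ℝ) ^ n := by positivity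
  nlinarith [mul_nonneg ha hb]

end AverageWave
end

/-! ### Duhamel terms: existence, uniqueness and expectation. -/

noncomputable section

namespace AverageWave

variable {d n : ℕ} {φ₀ : EuclideanSpace ℝ (Fin d) → ℂ} {t : ℝ} {ξ : EuclideanSpace ℝ (Fin d)}

lemma norm_fourierHat_le (φ₀ : EuclideanSpace ℝ (Fin d) → ℂ) (ξ : EuclideanSpace ℝ (Fin d)) :
    ‖fourierHat φ₀ ξ‖ ≤ ∫ x, ‖φ₀ x‖ := by
  refine (norm_integral_le_integral_norm _).trans (le_of_eq ?_)
  refine integral_congr_ae (ae_of_all _ fun x => ?_)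
  simp only
  rw [norm_mul, neg_mul, ← mul_neg, mul_comm Complex.I, ← Complex.ofReal_neg,
    Complex.norm_exp_ofReal_mul_I, mul_one]

lemma continuous_fourierHat (hφ₀ : Integrable φ₀) : Continuous (fourierHat φ₀) := by
  refine continuous_of_dominated (bound := fun x => ‖φ₀ x‖) (fun ξ => ?_)
    (fun ξ => ae_of_all _ fun x => ?_) hφ₀.norm (ae_of_all _ fun x => by fun_prop)
  · exact hφ₀.aestronglyMeasurable.mul (Continuous.aestronglyMeasurable (by fun_prop))
  · rw [norm_mul, neg_mul, ← mul_neg, mul_comm Complex.I, ← Complex.ofReal_neg,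
      Complex.norm_exp_ofReal_mul_I, mul_one]

lemma continuous_timeGrid (t : ℝ) : Continuous fun s : Fin n → ℝ => timeGrid t s := by
  refine continuous_pi fun j => ?_
  unfold timeGrid
  induction j using Fin.cases with
  | zero => simpa using continuous_const
  | succ j =>
    simp only [Fin.cons_succ]
    induction j using Fin.lastCases with
    | last => simpa using continuous_const
    | cast j => simpa using continuous_apply j

/-- The quadratic form `|ξ|²(t - s₁) + |ξ - p₁|²(s₁ - s₂) + … + |ξ - p₁ - … - pₙ|² sₙ`. -/
def phaseForm (t : ℝ) (ξ : EuclideanSpace ℝ (Fin d)) (s : Fin n → ℝ)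
    (p : Fin n → EuclideanSpace ℝ (Fin d)) : ℝ :=
  ∑ j : Fin (n + 1), ‖ξ - ∑ l : Fin n with l.castSucc < j, p l‖ ^ 2 *
    (timeGrid t s j.castSucc - timeGrid t s j.succ)

lemma duhamelKernel_eq (s : Fin n → ℝ) (p : Fin n → EuclideanSpace ℝ (Fin d)) :
    duhamelKernel φ₀ t ξ s p =
      Complex.exp (-(Complex.I / 2) * (phaseForm t ξ s p : ℂ)) * fourierHat φ₀ (ξ - ∑ l, p l) :=
  rfl

lemma continuous_phaseForm (t : ℝ) (ξ : EuclideanSpace ℝ (Fin d)) :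
    Continuous fun q : (Fin n → ℝ) × (Fin n → EuclideanSpace ℝ (Fin d)) =>
      phaseForm t ξ q.1 q.2 := by
  unfold phaseForm
  have h : ∀ j, Continuous fun q : (Fin n → ℝ) × (Fin n → EuclideanSpace ℝ (Fin d)) =>
      timeGrid t q.1 j :=
    fun j => (continuous_apply j).comp ((continuous_timeGrid t).comp continuous_fst)
  refine continuous_finsetSum _ fun j _ => Continuous.mul (by fun_prop) ((h _).sub (h _))

lemma continuous_duhamelKernel (hφ₀ : Integrable φ₀) (t : ℝ) (ξ : EuclideanSpace ℝ (Fin d)) :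
    Continuous fun q : (Fin n → ℝ) × (Fin n → EuclideanSpace ℝ (Fin d)) =>
      duhamelKernel φ₀ t ξ q.1 q.2 := by
  simp_rw [duhamelKernel_eq]
  have := continuous_phaseForm (n := n) t ξ
  refine Continuous.mul (by fun_prop) ((continuous_fourierHat hφ₀).comp (by fun_prop))

lemma norm_duhamelKernel_le (s : Fin n → ℝ) (p : Fin n → EuclideanSpace ℝ (Fin d)) :
    ‖duhamelKernel φ₀ t ξ s p‖ ≤ ∫ x, ‖φ₀ x‖ := by
  rw [duhamelKernel_eq, norm_mul]
  have : -(Complex.I / 2) * (phaseForm t ξ s p : ℂ) =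
      ((-(phaseForm t ξ s p) / 2 : ℝ) : ℂ) * Complex.I := by push_cast; ring
  rw [this, Complex.norm_exp_ofReal_mul_I, one_mul]
  exact norm_fourierHat_le _ _

section Solution

variable {Ω : Type*} [MeasurableSpace Ω] {μ : Measure ℝ≥0} [IsFiniteMeasure μ]
  {V : EuclideanSpace ℝ (Fin d) → Ω → ℝ} {P : Measure Ω}

/-- By the isometry, `‖J b - J a‖²` is the integral of a bounded symbol that tends to zero pointwise
as `b → a`. Continuity in the times makes the Duhamel terms Bochner integrable over the compact
simplex. -/
lemma continuous_of_isSpectralIntegral (hV : IsSpectralField μ V P) {A : Type*}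
    [TopologicalSpace A] [FirstCountableTopology A]
    {F : A → (Fin n → EuclideanSpace ℝ (Fin d)) → ℂ}
    (hF : Continuous fun q : A × (Fin n → EuclideanSpace ℝ (Fin d)) => F q.1 q.2)
    {C : ℝ} (hC : ∀ a p, ‖F a p‖ ≤ C) {J : A → Lp ℂ 2 P}
    (hJ : ∀ a, IsSpectralIntegral V P (F a) (J a)) : Continuous J := by
  refine continuous_iff_continuousAt.2 fun a => ?_
  rw [ContinuousAt, tendsto_iff_norm_sub_tendsto_zero]
  have h1 : Tendsto (fun b => ∫ p, pairSymbol (F b - F a) (F b - F a) p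
      ∂(momentMeasure d μ (n + n))) (𝓝 a) (𝓝 0) := by
    have hbd : ∀ b p, ‖(F b - F a) p‖ ≤ C + C := fun b p =>
      (norm_sub_le _ _).trans (add_le_add (hC _ _) (hC _ _))
    have hc : ∀ b, Continuous (F b - F a) := fun b => by
      have h1 : Continuous (F b) := hF.comp (by fun_prop : Continuous fun p => (b, p))
      have h2 : Continuous (F a) := hF.comp (by fun_prop : Continuous fun p => (a, p))
      exact h1.sub h2
    have h := tendsto_integral_filter_of_dominated_convergence
      (μ := momentMeasure d μ (n + n)) (l := 𝓝 a)
      (F := fun b p => pairSymbol (F b - F a) (F b - F a) p) (f := fun _ => 0)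
      (fun _ => (C + C) * (C + C))
      (Eventually.of_forall fun b => (continuous_pairSymbol (hc b) (hc b)).aestronglyMeasurable)
      (Eventually.of_forall fun b => ae_of_all _ (norm_pairSymbol_le (hbd b) (hbd b)))
      (integrable_const _) (ae_of_all _ fun p => ?_)
    · simpa using h
    · have hz : ∀ q, Tendsto (fun b => (F b - F a) q) (𝓝 a) (𝓝 0) := fun q => by
        have h1 : Continuous fun b => F b q := hF.comp (by fun_prop : Continuous fun b => (b, q))
        have := (h1.tendsto a).sub_const (F a q)
        simpa using this
      have := (hz fun j => p (Fin.castAdd n j)).mul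
        ((Complex.continuous_conj.tendsto _).comp (hz fun j => -p (Fin.natAdd n j)))
      simpa [pairSymbol, Function.comp_def] using this
  have h2 : ∀ b, ∫ p, pairSymbol (F b - F a) (F b - F a) p ∂(momentMeasure d μ (n + n)) =
      ((‖J b - J a‖ ^ 2 : ℝ) : ℂ) := fun b => (((hJ b).sub hV (hJ a)).norm_sq_eq hV).symm
  simp_rw [h2] at h1
  have h3 : Tendsto (fun b => ‖J b - J a‖ ^ 2) (𝓝 a) (𝓝 0) := by
    have := (Complex.continuous_re.tendsto _).comp h1
    simpa [Function.comp_def, ← Complex.ofReal_pow] using this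
  have := (Real.continuous_sqrt.tendsto _).comp h3
  simpa [Function.comp_def] using this

/-- The Duhamel terms exist, are integrable over the simplex, and are summable. -/
lemma exists_duhamel_terms (hV : IsSpectralField μ V P) (hφ₀ : Integrable φ₀) (t : ℝ≥0)
    (ξ : EuclideanSpace ℝ (Fin d)) :
    ∃ J : (n : ℕ) → (Fin n → ℝ) → Lp ℂ 2 P,
      (∀ n s, IsSpectralIntegral V P (duhamelKernel φ₀ t ξ s) (J n s)) ∧
      (∀ n, IntegrableOn (J n) (timeSimplex n t)) ∧
      Summable (fun n => (1 / Complex.I) ^ n • ∫ s in timeSimplex n t, J n s) := by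
  have h : ∀ (n : ℕ) (s : Fin n → ℝ),
      ∃ J : Lp ℂ 2 P, IsSpectralIntegral V P (duhamelKernel φ₀ t ξ s) J := by
    intro n s
    refine exists_isSpectralIntegral hV ?_ (norm_duhamelKernel_le s)
    exact Continuous.uncurry_left (f := duhamelKernel φ₀ t ξ) s (continuous_duhamelKernel hφ₀ t ξ)
  choose J hJ using h
  have hcont : ∀ n, Continuous (J n) := fun n =>
    continuous_of_isSpectralIntegral hV (F := duhamelKernel φ₀ t ξ)
      (continuous_duhamelKernel hφ₀ t ξ)
      (fun s p => norm_duhamelKernel_le s p) (hJ n)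
  refine ⟨J, hJ, fun n => (hcont n).continuousOn.integrableOn_compact isCompact_timeSimplex, ?_⟩
  set C := ∫ x, ‖φ₀ x‖ with hC
  have hC0 : 0 ≤ C := integral_nonneg fun _ => norm_nonneg _
  set M := (spectralMeasure d μ).real Set.univ
  have hM0 : 0 ≤ M := measureReal_nonneg
  refine Summable.of_norm_bounded (g := fun n : ℕ =>
    C * ((t * √(2 * M)) ^ n / √(n.factorial : ℝ)))
    ((summable_pow_div_sqrt_factorial _).mul_left C) fun n => ?_
  -- Square root of the bound `C² (2M)^n n!` from the mass of the pairing measure on `n + n` points.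
  have hJn : ∀ s, ‖J n s‖ ≤ C * (√(2 * M) ^ n * √(n.factorial : ℝ)) := by
    intro s
    refine abs_le_of_sq_le_sq' ?_ (by positivity) |>.2
    refine ((hJ n s).norm_le hV (norm_duhamelKernel_le s)).trans ?_
    rw [mul_pow, mul_pow, Real.sq_sqrt (by positivity), ← pow_mul, mul_comm n 2, pow_mul,
      Real.sq_sqrt (by positivity)]
    gcongr
    exact real_pairMeasure_two_mul_le _ n
  rw [norm_smul, norm_pow, norm_div, Complex.norm_I, norm_one, div_one, one_pow, one_mul]
  refine (norm_setIntegral_le_of_norm_le_const isCompact_timeSimplex.measure_lt_top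
    fun s _ => hJn s).trans (le_of_eq ?_)
  rw [volume_real_timeSimplex t.coe_nonneg, mul_pow]
  have h2 : (n.factorial : ℝ) = √(n.factorial : ℝ) * √(n.factorial : ℝ) :=
    (Real.mul_self_sqrt (by positivity)).symm
  have h3 : √(n.factorial : ℝ) ≠ 0 := by positivity
  rw [show (t : ℝ) ^ n / (n.factorial : ℝ) =
    (t : ℝ) ^ n / (√(n.factorial : ℝ) * √(n.factorial : ℝ)) by rw [← h2]]
  field_simp

/-- On the simplex the integrands are determined by uniqueness of spectral integrals. Their values
off the simplex do not enter, so any two solutions are sums of the same series. -/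
lemma existsUnique_isDuhamelSolution (hV : IsSpectralField μ V P) (hφ₀ : Integrable φ₀) :
    ∃! φ : ℝ≥0 → EuclideanSpace ℝ (Fin d) → Lp ℂ 2 P, IsDuhamelSolution V P φ₀ φ := by
  choose J hJ hJi hJs using exists_duhamel_terms hV hφ₀
  refine ⟨fun t ξ => ∑' n, (1 / Complex.I) ^ n • ∫ s in timeSimplex n t, J t ξ n s,
    fun t ξ => ⟨J t ξ, fun n s _ => hJ t ξ n s, hJi t ξ, (hJs t ξ).hasSum⟩, fun φ hφ => ?_⟩
  funext t ξ
  obtain ⟨K, hK, -, hKs⟩ := hφ t ξ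
  rw [← hKs.tsum_eq]
  refine tsum_congr fun n => ?_
  congr 1
  exact setIntegral_congr_fun measurableSet_timeSimplex
    fun s hs => (hK n s hs).unique hV (hJ t ξ n s)

/-- The expectation of the `n`-th term of the Duhamel series, up to the factor `i⁻ⁿ φ̂₀(ξ)`, with
`i` replaced by `z²`. -/
def expansionTerm (μ : Measure ℝ≥0) (t : ℝ) (ξ : EuclideanSpace ℝ (Fin d)) (n : ℕ) (z : ℂ) : ℂ :=
  ∫ s in timeSimplex n t, ∫ p, Complex.exp (-(z ^ 2 / 2) * (phaseForm t ξ s p : ℂ))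
    ∂(momentMeasure d μ n)

lemma sqrtI_sq : sqrtI ^ 2 = Complex.I := by
  have h : ((Real.sqrt 2 : ℝ) : ℂ) ^ 2 = 2 := by
    rw [← Complex.ofReal_pow, Real.sq_sqrt (by norm_num)]; norm_num
  rw [sqrtI, div_pow, h]
  ring_nf
  rw [Complex.I_sq]
  ring

/-- Expectation is the continuous functional `⟨1, ·⟩`, so it passes through the series and the
Bochner integral. The momenta sum to zero almost everywhere under the pairing measure, which
replaces `φ̂₀(ξ - ∑ p)` by `φ̂₀(ξ)`. -/
lemma IsDuhamelSolution.hasSum_integral [IsProbabilityMeasure P] (hV : IsSpectralField μ V P)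
    {φ : ℝ≥0 → EuclideanSpace ℝ (Fin d) → Lp ℂ 2 P} (hφ : IsDuhamelSolution V P φ₀ φ) (t : ℝ≥0)
    (ξ : EuclideanSpace ℝ (Fin d)) :
    HasSum (fun n => fourierHat φ₀ ξ * ((1 / Complex.I) ^ n * expansionTerm μ t ξ n sqrtI))
      (∫ ω, φ t ξ ω ∂P) := by
  obtain ⟨J, hJ, hJi, hJs⟩ := hφ t ξ
  let ℓ : Lp ℂ 2 P →L[ℂ] ℂ := innerSL ℂ
    (indicatorConstLp 2 MeasurableSet.univ (measure_ne_top P Set.univ) (1 : ℂ))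
  have hℓ : ∀ f : Lp ℂ 2 P, ℓ f = ∫ ω, f ω ∂P := by
    intro f
    rw [innerSL_apply_apply, L2.inner_indicatorConstLp_one, Measure.restrict_univ]
  have h := ℓ.hasSum hJs
  rw [hℓ] at h
  convert h using 2 with n
  rw [map_smul, ← ContinuousLinearMap.integral_comp_comm ℓ (hJi n)]
  simp_rw [hℓ]
  rw [smul_eq_mul, expansionTerm, mul_left_comm, ← integral_const_mul]
  congr 1
  refine setIntegral_congr_fun measurableSet_timeSimplex fun s hs => ?_
  rw [(hJ n s hs).integral_eq hV, ← integral_const_mul]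
  refine integral_congr_ae ?_
  filter_upwards [sum_eq_zero_ae_pairMeasure (spectralMeasure d μ) n] with p hp
  rw [duhamelKernel_eq, hp, sub_zero, sqrtI_sq, mul_comm]

end Solution

end AverageWave
end

/-! ### Fourier transforms of Brownian increments. -/

noncomputable section

namespace AverageWave

section Grid

variable {n : ℕ} {t : ℝ} {s : Fin n → ℝ}

@[simp] lemma timeGrid_zero : timeGrid t s 0 = t := rfl

@[simp] lemma timeGrid_last : timeGrid t s (Fin.last (n + 1)) = 0 := by
  rw [← Fin.succ_last, timeGrid, Fin.cons_succ, Fin.snoc_last]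

@[simp] lemma timeGrid_castSucc_succ (l : Fin n) : timeGrid t s l.castSucc.succ = s l := by
  rw [timeGrid, Fin.cons_succ, Fin.snoc_castSucc]

lemma timeGrid_antitone (hs : s ∈ timeSimplex n t) (ht : 0 ≤ t) : Antitone (timeGrid t s) := by
  have h1 : ∀ j, 0 ≤ timeGrid t s j ∧ timeGrid t s j ≤ t := by
    intro j
    induction j using Fin.cases with
    | zero => simp [ht]
    | succ j =>
      induction j using Fin.lastCases with
      | last => rw [Fin.succ_last, timeGrid_last]; exact ⟨le_rfl, ht⟩
      | cast j => rw [timeGrid_castSucc_succ]; exact hs.2 j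
  intro i j hij
  induction i using Fin.cases with
  | zero => simpa using (h1 j).2
  | succ i =>
    induction j using Fin.cases with
    | zero => exact absurd hij (by simp)
    | succ j =>
      induction j using Fin.lastCases with
      | last => rw [Fin.succ_last, timeGrid_last]; exact (h1 _).1
      | cast j =>
        induction i using Fin.lastCases with
        | last =>
          have : Fin.last n ≤ j.castSucc := Fin.succ_le_succ_iff.1 hij
          exact absurd this (by simp [Fin.le_def])
        | cast i =>
          rw [timeGrid_castSucc_succ, timeGrid_castSucc_succ]
          exact hs.1 (Fin.castSucc_le_castSucc_iff.1 (Fin.succ_le_succ_iff.1 hij))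

end Grid

/-- Summation by parts. -/
lemma sum_inner_sub_eq {E : Type*} [NormedAddCommGroup E] [InnerProductSpace ℝ E] {n : ℕ}
    (ξ : E) (p : Fin n → E) (f : Fin (n + 2) → E) :
    ∑ j : Fin (n + 1), inner ℝ (ξ - ∑ l : Fin n with l.castSucc < j, p l)
        (f j.castSucc - f j.succ) =
      inner ℝ ξ (f 0) - ∑ l, inner ℝ (p l) (f l.castSucc.succ) -
        inner ℝ (ξ - ∑ l, p l) (f (Fin.last (n + 1))) := by
  induction n generalizing ξ with
  | zero => simp [inner_sub_right, Fin.last]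
  | succ n ih =>
    rw [Fin.sum_univ_succ]
    have h1 : ∀ j : Fin (n + 1), ξ - ∑ l : Fin (n + 1) with l.castSucc < j.succ, p l =
        (ξ - p 0) - ∑ l : Fin n with l.castSucc < j, p l.succ := by
      intro j
      rw [Finset.sum_filter, Finset.sum_filter, Fin.sum_univ_succ]
      simp only [Fin.castSucc_zero, Fin.succ_pos, if_true, ← Fin.succ_castSucc,
        Fin.succ_lt_succ_iff]
      abel
    simp_rw [h1]
    have h2 := ih (ξ - p 0) (fun l => p l.succ) (fun j => f j.succ)
    simp only [Fin.succ_castSucc, Fin.succ_last] at h2 ⊢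
    rw [h2, Fin.sum_univ_succ (n := n), Fin.sum_univ_succ (n := n)]
    have h3 : f (Fin.succ (0 : Fin (n + 1))).castSucc = f (Fin.succ (0 : Fin (n + 2))) := rfl
    simp only [h3, inner_sub_left, inner_sub_right, Fin.not_lt_zero,
      Finset.filter_false, Finset.sum_empty, inner_zero_left, inner_add_left, Fin.castSucc_zero]
    ring

section Brownian

variable {d n : ℕ} {S : Type*} [MeasurableSpace S] {Q : Measure S}
  {B : ℝ≥0 → S → EuclideanSpace ℝ (Fin d)}

lemma IsStandardBrownian.aemeasurable (hB : IsStandardBrownian B Q) (t : ℝ≥0) :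
    AEMeasurable (B t) Q := by
  have h : AEMeasurable (fun ω j => B t ω j) Q :=
    aemeasurable_pi_lambda _ fun j => (hB.coord j).aemeasurable t
  exact (PiLp.continuous_toLp 2 _).measurable.comp_aemeasurable h

/-- The characteristic function of a linear combination of increments. -/
lemma IsStandardBrownian.charFun_sum_increments (hB : IsStandardBrownian B Q)
    (q : Fin n → EuclideanSpace ℝ (Fin d)) {τ : Fin (n + 1) → ℝ≥0} (hτ : Antitone τ) (z : ℝ) :
    charFun (Q.map fun ω => ∑ j, inner ℝ (q j) (B (τ j.castSucc) ω - B (τ j.succ) ω)) z =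
      Complex.exp (-((z : ℂ) ^ 2 / 2) *
        ((∑ j, ‖q j‖ ^ 2 * ((τ j.castSucc : ℝ) - τ j.succ) : ℝ) : ℂ)) := by
  let X : Fin d → Fin n → S → ℝ := fun c j ω => B (τ j.castSucc) ω c - B (τ j.succ) ω c
  have hXm : ∀ c j, AEMeasurable (X c j) Q := fun c j =>
    ((hB.coord c).aemeasurable _).sub ((hB.coord c).aemeasurable _)
  have hXlaw : ∀ c j (a : ℝ), charFun (Q.map fun ω => a * X c j ω) z =
      Complex.exp (-((z : ℂ) ^ 2 / 2) *
        ((a ^ 2 * ((τ j.castSucc : ℝ) - τ j.succ) : ℝ) : ℂ)) := by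
    intro c j a
    obtain ⟨v, hv, hlaw⟩ : ∃ v : ℝ≥0, (v : ℝ) = (τ j.castSucc : ℝ) - τ j.succ ∧
        HasLaw (X c j) (gaussianReal 0 v) Q := by
      refine ⟨_, ?_, (hB.coord c).hasLaw_sub (τ j.castSucc) (τ j.succ)⟩
      rw [coe_nndist, Real.dist_eq, abs_of_nonneg]
      · rfl
      · exact sub_nonneg.2 (NNReal.coe_le_coe.2 (hτ (Fin.castSucc_lt_succ).le))
    have h1 : Q.map (fun ω => a * X c j ω) = (gaussianReal 0 v).map (a * ·) := by
      rw [← hlaw.map_eq, AEMeasurable.map_map_of_aemeasurable (by fun_prop) (hXm c j)]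
      rfl
    rw [h1, charFun_map_mul, charFun_gaussianReal, ← hv]
    congr 1
    push_cast
    ring
  have hXind : ∀ c, iIndepFun (fun j ω => X c j ω) Q := by
    intro c
    -- Independence of increments is stated for increasing times, whereas `τ` decreases; the grid is
    -- reversed and the indices are reversed back afterwards.
    have h := (hB.coord c).hasIndepIncrements n (fun i => τ i.rev)
      (fun i j hij => hτ (Fin.rev_le_rev.2 hij))
    have h2 := h.precomp (g := Fin.rev) Fin.rev_injective
    simpa only [Fin.rev_succ, Fin.rev_castSucc, Fin.rev_rev] using h2
  have hsum : ∀ c, charFun (Q.map fun ω => ∑ j, q j c * X c j ω) z =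
      ∏ j, Complex.exp (-((z : ℂ) ^ 2 / 2) *
        (((q j c) ^ 2 * ((τ j.castSucc : ℝ) - τ j.succ) : ℝ) : ℂ)) := by
    intro c
    have h := (hXind c).comp (fun j x => q j c * x) (fun j => by fun_prop)
    rw [iIndepFun.charFun_map_fun_sum_eq_prod (X := fun j ω => q j c * X c j ω)
      (fun j => (hXm c j).const_mul _) h, Finset.prod_apply]
    exact Finset.prod_congr rfl fun j _ => hXlaw c j _
  have hind : iIndepFun (fun (c : Fin d) ω => ∑ j, q j c * X c j ω) Q :=
    hB.indep.comp (fun c (f : ℝ≥0 → ℝ) => ∑ j, q j c * (f (τ j.castSucc) - f (τ j.succ)))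
      (fun c => by fun_prop)
  -- Grouping by coordinate first uses independence of the coordinates; within a coordinate the
  -- increments are independent.
  have hfun : (fun ω => ∑ j, inner ℝ (q j) (B (τ j.castSucc) ω - B (τ j.succ) ω)) =
      fun ω => ∑ c, ∑ j, q j c * X c j ω := by
    funext ω
    rw [Finset.sum_comm]
    refine Finset.sum_congr rfl fun j _ => ?_
    rw [PiLp.inner_apply]
    refine Finset.sum_congr rfl fun c _ => ?_
    simp [X, mul_comm]
  rw [hfun, iIndepFun.charFun_map_fun_sum_eq_prod (fun c => ?_) hind, Finset.prod_apply,
    Finset.prod_congr rfl fun c _ => hsum c]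
  · simp_rw [← Complex.exp_sum]
    congr 1
    simp_rw [← Finset.mul_sum, ← Complex.ofReal_sum]
    congr 2
    rw [Finset.sum_comm]
    refine Finset.sum_congr rfl fun j _ => ?_
    rw [← Finset.sum_mul, EuclideanSpace.real_norm_sq_eq]
  · exact Finset.aemeasurable_fun_sum _ fun j _ => (hXm c j).const_mul _

lemma IsStandardBrownian.ae_zero (hB : IsStandardBrownian B Q) : ∀ᵐ ω ∂Q, B 0 ω = 0 := by
  filter_upwards [ae_all_iff.2 fun j => (hB.coord j).eval_zero_ae_eq_zero] with ω hω
  ext j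
  simpa using hω j

/-- The Fourier transform of the law of Brownian motion at finitely many ordered times. -/
lemma IsStandardBrownian.charFun_sub_sum (hB : IsStandardBrownian B Q) (t : ℝ≥0)
    (ξ : EuclideanSpace ℝ (Fin d)) {s : Fin n → ℝ} (hs : s ∈ timeSimplex n t)
    (p : Fin n → EuclideanSpace ℝ (Fin d)) (z : ℝ) :
    charFun (Q.map fun ω => inner ℝ ξ (B t ω) - ∑ l, inner ℝ (p l) (B (s l).toNNReal ω)) z =
      Complex.exp (-((z : ℂ) ^ 2 / 2) * (phaseForm t ξ s p : ℂ)) := by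
  let τ : Fin (n + 2) → ℝ≥0 := fun j => (timeGrid t s j).toNNReal
  have hanti := timeGrid_antitone hs t.coe_nonneg
  have hτ : Antitone τ := fun i j hij => Real.toNNReal_le_toNNReal (hanti hij)
  have h0 : ∀ j, 0 ≤ timeGrid t s j := fun j => by
    simpa using hanti (Fin.le_last j)
  have hτc : ∀ j, (τ j : ℝ) = timeGrid t s j := fun j => Real.coe_toNNReal _ (h0 j)
  have h := hB.charFun_sum_increments
    (fun j : Fin (n + 1) => ξ - ∑ l : Fin n with l.castSucc < j, p l) hτ z
  simp_rw [hτc] at h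
  rw [phaseForm, ← h]
  congr 1
  refine Measure.map_congr ?_
  filter_upwards [hB.ae_zero] with ω hω
  -- Increments weighted by `ξ - p₁ - … - p_j` recombine to `ξ·B_t - ∑ p_l·B_{s_l}`; the boundary
  -- term at time `0` vanishes almost surely.
  rw [sum_inner_sub_eq ξ p (fun j => B (τ j) ω)]
  simp [τ, hω]

/-- The case of no intermediate times identifies the law of `ξ·B_t` as Gaussian with variance `|ξ|²
t`. -/
lemma IsStandardBrownian.integrable_exp [IsProbabilityMeasure Q] (hB : IsStandardBrownian B Q) (t : ℝ≥0)
    (ξ : EuclideanSpace ℝ (Fin d)) (c : ℝ) :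
    Integrable (fun ω => Real.exp (c * inner ℝ ξ (B t ω))) Q := by
  have hm : AEMeasurable (fun ω => inner ℝ ξ (B t ω)) Q :=
    (by fun_prop : Measurable fun x : EuclideanSpace ℝ (Fin d) => inner ℝ ξ x).comp_aemeasurable
      (hB.aemeasurable t)
  have hlaw : Q.map (fun ω => inner ℝ ξ (B t ω)) = gaussianReal 0 (‖ξ‖₊ ^ 2 * t) := by
    have : IsProbabilityMeasure (Q.map (fun ω => inner ℝ ξ (B t ω))) :=
      Measure.isProbabilityMeasure_map hm
    refine Measure.ext_of_charFun (funext fun z => ?_)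
    have h := hB.charFun_sub_sum (n := 0) t ξ (s := 0)
      ⟨fun i => i.elim0, fun i => i.elim0⟩ 0 z
    simp only [Finset.univ_eq_empty, Finset.sum_empty, sub_zero] at h
    rw [h, charFun_gaussianReal, phaseForm]
    congr 1
    have h1 : ∀ s : Fin 0 → ℝ, timeGrid (t : ℝ) s 1 = 0 := fun s => timeGrid_last
    simp [h1]
    ring
  have h := integrable_exp_mul_gaussianReal (μ := 0) (v := ‖ξ‖₊ ^ 2 * t) c
  rw [← hlaw] at h
  exact (integrable_map_measure (by fun_prop) hm).1 h

/-- Brownian motion has a version with measurable marginals and with all paths continuous that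
is indistinguishable from it. -/
lemma IsStandardBrownian.exists_continuous_version (hB : IsStandardBrownian B Q) :
    ∃ B' : ℝ≥0 → S → EuclideanSpace ℝ (Fin d), (∀ t, Measurable (B' t)) ∧
      (∀ ω, Continuous fun t => B' t ω) ∧ ∀ᵐ ω ∂Q, ∀ t, B' t ω = B t ω := by
  have hcont : ∀ᵐ ω ∂Q, Continuous fun t => B t ω := by
    filter_upwards [ae_all_iff.2 fun j => (hB.coord j).cont] with ω hω
    exact (PiLp.continuous_toLp 2 _).comp (continuous_pi hω)
  let D := TopologicalSpace.denseSeq ℝ≥0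
  have hgood : ∀ᵐ ω ∂Q, (Continuous fun t => B t ω) ∧
      ∀ k, B (D k) ω = (hB.aemeasurable (D k)).mk (B (D k)) ω :=
    hcont.and (ae_all_iff.2 fun k => (hB.aemeasurable (D k)).ae_eq_mk)
  obtain ⟨A, hAsub, hAm, hA0⟩ := exists_measurable_superset_of_null hgood
  have hA : ∀ ω ∉ A, (Continuous fun t => B t ω) ∧
      ∀ k, B (D k) ω = (hB.aemeasurable (D k)).mk (B (D k)) ω := by
    intro ω hω
    by_contra h
    exact hω (hAsub h)
  -- Paths in the null set `A` are replaced by zero. Off `A`, `B t` is a limit of measurable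
  -- representatives at dense times, which gives genuine measurability; continuity then gives the
  -- joint measurability required by Fubini.
  refine ⟨fun t => Aᶜ.indicator (B t), fun t => ?_, fun ω => ?_, ?_⟩
  · have ht : t ∈ closure (Set.range D) := TopologicalSpace.denseRange_denseSeq ℝ≥0 t
    obtain ⟨u, hu, hut⟩ := mem_closure_iff_seq_limit.1 ht
    choose k hk using hu
    refine measurable_of_tendsto_metrizable
      (f := fun i => Aᶜ.indicator ((hB.aemeasurable (D (k i))).mk (B (D (k i)))))
      (fun i => (hB.aemeasurable (D (k i))).measurable_mk.indicator hAm.compl)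
      (tendsto_pi_nhds.2 fun ω => ?_)
    by_cases hω : ω ∈ A
    · simp [hω]
    · simp only [Set.indicator_of_mem (show ω ∈ Aᶜ from hω)]
      simp_rw [← (hA ω hω).2, hk]
      exact ((hA ω hω).1.tendsto t).comp hut
  · by_cases hω : ω ∈ A
    · simpa [hω] using continuous_const
    · simpa [Set.indicator_of_mem (show ω ∈ Aᶜ from hω)] using (hA ω hω).1
  · filter_upwards [measure_eq_zero_iff_ae_notMem.1 hA0] with ω hω t
    rw [Set.indicator_of_mem (show ω ∈ Aᶜ from hω)]

end Brownian

end AverageWave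
end

/-! ### Resummation along a fixed path, for real `z`. -/

noncomputable section

namespace AverageWave

/-- The generating function of a sequence satisfying the recursion of Gaussian moments. -/
lemma hasSum_of_gaussian_recursion {M : ℕ → ℂ} {c : ℂ} (h0 : M 0 = 1) (h1 : M 1 = 0)
    (h2 : ∀ n, M (n + 2) = (n + 1) * c * M n) :
    HasSum (fun n => (1 / Complex.I) ^ n * (M n / n.factorial)) (Complex.exp (-(1 / 2) * c)) := by
  have hodd : ∀ k, M (2 * k + 1) = 0 := by
    intro k
    induction k with
    | zero => simpa using h1
    | succ k ih => rw [show 2 * (k + 1) + 1 = 2 * k + 1 + 2 by ring, h2, ih, mul_zero]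
  -- The recursion gives `M(2k) = (2k-1)!! c^k`, and `(2k)! = (2k-1)!! 2^k k!`.
  have heven : ∀ k, M (2 * k) / (2 * k).factorial = (c / 2) ^ k / k.factorial := by
    intro k
    induction k with
    | zero => simp [h0]
    | succ k ih =>
      have hk : ((k : ℂ) + 1) ≠ 0 := Nat.cast_add_one_ne_zero k
      have hk2 : (2 * (k : ℂ) + 1) ≠ 0 := by exact_mod_cast Nat.succ_ne_zero (2 * k)
      have hf : ((2 * k).factorial : ℂ) ≠ 0 := by exact_mod_cast Nat.factorial_ne_zero _
      have hf' : (k.factorial : ℂ) ≠ 0 := by exact_mod_cast Nat.factorial_ne_zero _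
      have h3 : M (2 * (k + 1)) / (2 * (k + 1)).factorial =
          c / 2 / (k + 1) * (M (2 * k) / (2 * k).factorial) := by
        rw [show 2 * (k + 1) = 2 * k + 2 by ring, h2, Nat.factorial_succ, Nat.factorial_succ]
        push_cast
        rw [show (2 * (k : ℂ) + 1 + 1) = 2 * (k + 1) by ring]
        field_simp
      rw [h3, ih, Nat.factorial_succ, pow_succ]
      push_cast
      field_simp
  have he : HasSum (fun k => (1 / Complex.I) ^ (2 * k) * (M (2 * k) / (2 * k).factorial))
      (Complex.exp (-(1 / 2) * c)) := by
    have h := NormedSpace.expSeries_div_hasSum_exp (-(1 / 2) * c)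
    rw [← Complex.exp_eq_exp_ℂ] at h
    have hfe : (fun k => (1 / Complex.I) ^ (2 * k) * (M (2 * k) / (2 * k).factorial)) =
        fun k => (-(1 / 2) * c) ^ k / k.factorial := by
      funext k
      rw [heven, pow_mul, ← mul_div_assoc, ← mul_pow]
      congr 2
      rw [div_pow, Complex.I_sq]
      ring
    rw [hfe]
    exact h
  have ho : HasSum (fun k => (1 / Complex.I) ^ (2 * k + 1) *
      (M (2 * k + 1) / (2 * k + 1).factorial)) 0 := by
    simp_rw [hodd, zero_div, mul_zero]
    exact hasSum_zero
  have h := HasSum.even_add_odd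
    (f := fun n => (1 / Complex.I) ^ n * (M n / n.factorial)) he ho
  rwa [add_zero] at h

variable {d n : ℕ} {μ : Measure ℝ≥0} [IsFiniteMeasure μ]

/-- The symmetric function `∫ exp(-i z ∑_j p_j·x_j) m_n(dp)` of `n` points. -/
def momentTransform (μ : Measure ℝ≥0) (z : ℝ) (x : Fin n → EuclideanSpace ℝ (Fin d)) : ℂ :=
  ∫ p, Complex.exp (-(Complex.I * z) * ((∑ j, inner ℝ (p j) (x j) : ℝ) : ℂ))
    ∂(momentMeasure d μ n)

lemma norm_exp_neg_I_mul (z r : ℝ) : ‖Complex.exp (-(Complex.I * z) * (r : ℂ))‖ = 1 := by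
  rw [show -(Complex.I * z) * (r : ℂ) = ((-(z * r) : ℝ) : ℂ) * Complex.I by push_cast; ring,
    Complex.norm_exp_ofReal_mul_I]

lemma continuous_momentTransform (z : ℝ) :
    Continuous fun x : Fin n → EuclideanSpace ℝ (Fin d) => momentTransform μ z x := by
  refine continuous_of_dominated (bound := fun _ => 1)
    (fun x => Continuous.aestronglyMeasurable (by fun_prop))
    (fun x => ae_of_all _ fun p => (norm_exp_neg_I_mul _ _).le) (integrable_const _)
    (ae_of_all _ fun p => by fun_prop)

lemma norm_momentTransform_le (z : ℝ) (x : Fin n → EuclideanSpace ℝ (Fin d)) :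
    ‖momentTransform μ z x‖ ≤ (momentMeasure d μ n).real Set.univ := by
  have h := norm_integral_le_of_norm_le_const (μ := momentMeasure d μ n) (C := 1)
    (f := fun p => Complex.exp (-(Complex.I * z) * ((∑ j, inner ℝ (p j) (x j) : ℝ) : ℂ)))
    (ae_of_all _ fun p => (norm_exp_neg_I_mul z _).le)
  rwa [one_mul] at h

/-- The recursion for `pairMeasure` singles out one point and hides the symmetry. It becomes evident
in the form `E ∏ V(-z x_j)`. -/
lemma momentTransform_comp_perm {Ω : Type*} [MeasurableSpace Ω] {P : Measure Ω}
    {V : EuclideanSpace ℝ (Fin d) → Ω → ℝ} (hV : IsSpectralField μ V P) (z : ℝ)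
    (σ : Equiv.Perm (Fin n)) (x : Fin n → EuclideanSpace ℝ (Fin d)) :
    momentTransform μ z (x ∘ σ) = momentTransform μ z x := by
  have h : ∀ y : Fin n → EuclideanSpace ℝ (Fin d), momentTransform μ z y =
      ((∫ ω, ∏ j, V (-z • y j) ω ∂P : ℝ) : ℂ) := by
    intro y
    rw [integral_prod_eq_integral_pairMeasure μ hV.gaussian hV.mean hV.cov n fun j => -z • y j]
    refine integral_congr_ae (ae_of_all _ fun p => ?_)
    simp only [inner_smul_right]
    rw [← Finset.mul_sum]
    congr 1
    push_cast
    ring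
  rw [h, h]
  congr 1
  refine integral_congr_ae (ae_of_all _ fun ω => ?_)
  exact Equiv.prod_comp σ fun j => V (-z • x j) ω

/-- Over the cube the character factors into `∏ g(p_j)` with `g(p) = ∫₀ᵗ exp(-iz p·x_s) ds`, so the
product recursion for pairing measures applies. Its variance `∫ g(q) g(-q)` is the path energy. -/
lemma integral_timeCube_momentTransform_add_two (z : ℝ) (t : ℝ)
    {x : ℝ → EuclideanSpace ℝ (Fin d)} (hx : Continuous x) (n : ℕ) :
    ∫ s in timeCube (n + 2) t, momentTransform μ z (fun j => x (s j)) =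
      (n + 1) * (∫ q in Set.Icc 0 t ×ˢ Set.Icc 0 t, extR μ z (x q.1 - x q.2)) *
        ∫ s in timeCube n t, momentTransform μ z (fun j => x (s j)) := by
  have hfin : ∀ n, IsFiniteMeasure ((volume : Measure (Fin n → ℝ)).restrict (timeCube n t)) :=
    fun n => isFiniteMeasure_restrict.2 isCompact_timeCube.measure_lt_top.ne
  have hfin1 : IsFiniteMeasure ((volume : Measure ℝ).restrict (Set.Icc 0 t)) :=
    isFiniteMeasure_restrict.2 isCompact_Icc.measure_lt_top.ne
  let g : EuclideanSpace ℝ (Fin d) → ℂ := fun p =>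
    ∫ s in Set.Icc 0 t, Complex.exp (-(Complex.I * z) * ((inner ℝ p (x s) : ℝ) : ℂ))
  have hg : Continuous g := by
    refine continuous_of_dominated (bound := fun _ => 1)
      (fun p => Continuous.aestronglyMeasurable (by fun_prop))
      (fun p => ae_of_all _ fun s => (norm_exp_neg_I_mul _ _).le) (integrable_const _)
      (ae_of_all _ fun s => by fun_prop)
  have hgb : ∀ p, ‖g p‖ ≤ 1 * ((volume : Measure ℝ).restrict (Set.Icc 0 t)).real Set.univ :=
    fun p => norm_integral_le_of_norm_le_const
      (ae_of_all _ fun s => (norm_exp_neg_I_mul z _).le)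
  have hM : ∀ n, ∫ s in timeCube n t, momentTransform μ z (fun j => x (s j)) =
      ∫ p, ∏ j, g (p j) ∂(momentMeasure d μ n) := by
    intro n
    unfold momentTransform
    have := hfin n
    rw [integral_integral_swap]
    · refine integral_congr_ae (ae_of_all _ fun p => ?_)
      simp only
      rw [timeCube, volume_pi, Measure.restrict_pi_pi, ← integral_fintype_prod_eq_prod
        (f := fun j s => Complex.exp (-(Complex.I * z) * ((inner ℝ (p j) (x s) : ℝ) : ℂ)))]
      refine integral_congr_ae (ae_of_all _ fun s => ?_)
      simp only
      rw [← Complex.exp_sum, ← Finset.mul_sum]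
      push_cast
      rfl
    · refine Integrable.of_bound (C := 1) (Continuous.aestronglyMeasurable ?_)
        (ae_of_all _ fun w => (norm_exp_neg_I_mul _ _).le)
      simp only [Function.uncurry_def]
      fun_prop
  have hc : ∫ q, g q * g (-q) ∂(spectralMeasure d μ) =
      ∫ q in Set.Icc 0 t ×ˢ Set.Icc 0 t, extR μ z (x q.1 - x q.2) := by
    have h1 : ∀ q, g q * g (-q) = ∫ w in Set.Icc 0 t ×ˢ Set.Icc 0 t,
        Complex.exp (-(Complex.I * z) * ((inner ℝ q (x w.1 - x w.2) : ℝ) : ℂ)) := by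
      intro q
      rw [Measure.volume_eq_prod, ← setIntegral_prod_mul]
      refine integral_congr_ae (ae_of_all _ fun w => ?_)
      simp only
      rw [← Complex.exp_add, ← mul_add, inner_neg_left, inner_sub_right, sub_eq_add_neg]
      push_cast
      rfl
    have hfin2 : IsFiniteMeasure ((volume : Measure (ℝ × ℝ)).restrict
        (Set.Icc 0 t ×ˢ Set.Icc 0 t)) :=
      isFiniteMeasure_restrict.2 (isCompact_Icc.prod isCompact_Icc).measure_lt_top.ne
    simp_rw [h1]
    rw [integral_integral_swap]
    · refine integral_congr_ae (ae_of_all _ fun w => ?_)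
      simp only
      have h2 := integral_exp_spectralMeasure μ (-z • (x w.1 - x w.2))
      rw [norm_smul, norm_neg] at h2
      -- `ρ` is even, so a real `z` may be replaced by `|z|`, matching the norm of `-z • (x w.1 - x
      -- w.2)`.
      have h3 : extR μ z (x w.1 - x w.2) = rho μ ((‖z‖ * ‖x w.1 - x w.2‖ : ℝ) : ℂ) := by
        rw [extR, rho, rho]
        refine integral_congr_ae (ae_of_all _ fun l => ?_)
        simp only
        congr 3
        have : (z : ℂ) ^ 2 = ((‖z‖ : ℝ) : ℂ) ^ 2 := by
          rw [← Complex.ofReal_pow, ← Complex.ofReal_pow, Real.norm_eq_abs, sq_abs]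
        push_cast
        rw [mul_pow, mul_pow, mul_pow, mul_pow, this]
      rw [h3, ← h2]
      refine integral_congr_ae (ae_of_all _ fun q => ?_)
      simp only [inner_smul_right]
      congr 1
      push_cast
      ring
    · refine Integrable.of_bound (C := 1) (Continuous.aestronglyMeasurable ?_)
        (ae_of_all _ fun w => (norm_exp_neg_I_mul _ _).le)
      simp only [Function.uncurry_def]
      fun_prop
  rw [hM, hM, ← hc]
  exact integral_prod_pairMeasure_add_two _ n hg.measurable hgb

/-- The expansion of the exponential of the path functional, for real `z`. -/
lemma hasSum_momentTransform {Ω : Type*} [MeasurableSpace Ω] {P : Measure Ω}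
    {V : EuclideanSpace ℝ (Fin d) → Ω → ℝ} (hV : IsSpectralField μ V P) (z t : ℝ)
    {x : ℝ → EuclideanSpace ℝ (Fin d)} (hx : Continuous x) :
    HasSum (fun n => (1 / Complex.I) ^ n *
        ∫ s in timeSimplex n t, momentTransform μ z (fun j => x (s j)))
      (Complex.exp (-(1 / 2) *
        ∫ q in Set.Icc 0 t ×ˢ Set.Icc 0 t, extR μ z (x q.1 - x q.2))) := by
  have hcont : ∀ n, Continuous fun s : Fin n → ℝ => momentTransform μ z (fun j => x (s j)) :=
    fun n => (continuous_momentTransform z).comp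
      (f := fun (s : Fin n → ℝ) j => x (s j)) (by fun_prop)
  have h := hasSum_of_gaussian_recursion
    (M := fun n => ∫ s in timeCube n t, momentTransform μ z (fun j => x (s j))) ?_ ?_
    (integral_timeCube_momentTransform_add_two (μ := μ) z t hx)
  · convert h using 3 with n
    rw [integral_timeCube_eq ((hcont n).continuousOn.integrableOn_compact isCompact_timeCube)
      fun σ s => momentTransform_comp_perm hV z σ (fun j => x (s j)),
      mul_div_cancel_left₀ _ (by exact_mod_cast Nat.factorial_ne_zero n)]
  · have : timeCube 0 t = Set.univ := by
      ext s; simp [timeCube]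
    have hvol : (volume : Measure (Fin 0 → ℝ)).real Set.univ = 1 := by
      rw [Measure.real, ← Set.pi_univ, volume_pi_pi]
      simp
    simp [momentTransform, momentMeasure, pairMeasure, this, hvol]
  · simp [momentTransform, momentMeasure, pairMeasure]

/-- Mass at most `√(M^n n!)` times volume `t^n/n!`. The majorant depends neither on the path nor on
`z`, so it serves both dominated convergence and continuation. -/
lemma norm_setIntegral_timeSimplex_le {t : ℝ} (ht : 0 ≤ t) {f : (Fin n → ℝ) → ℂ}
    (hf : ∀ s ∈ timeSimplex n t, ‖f s‖ ≤ (momentMeasure d μ n).real Set.univ) :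
    ‖∫ s in timeSimplex n t, f s‖ ≤
      (t * √((spectralMeasure d μ).real Set.univ)) ^ n / √(n.factorial : ℝ) := by
  refine (norm_setIntegral_le_of_norm_le_const isCompact_timeSimplex.measure_lt_top hf).trans ?_
  rw [volume_real_timeSimplex ht]
  set M := (spectralMeasure d μ).real Set.univ
  have hM0 : 0 ≤ M := measureReal_nonneg
  have h1 : (momentMeasure d μ n).real Set.univ ≤ √M ^ n * √(n.factorial : ℝ) := by
    refine abs_le_of_sq_le_sq' ?_ (by positivity) |>.2
    refine (real_pairMeasure_sq_le (spectralMeasure d μ) n).trans (le_of_eq ?_)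
    rw [mul_pow, Real.sq_sqrt (by positivity), ← pow_mul, mul_comm n 2, pow_mul,
      Real.sq_sqrt hM0]
  have h2 : (n.factorial : ℝ) = √(n.factorial : ℝ) * √(n.factorial : ℝ) :=
    (Real.mul_self_sqrt (by positivity)).symm
  have h3 : √(n.factorial : ℝ) ≠ 0 := by positivity
  calc _ ≤ √M ^ n * √(n.factorial : ℝ) * (t ^ n / n.factorial) := by gcongr
    _ = √M ^ n * √(n.factorial : ℝ) * (t ^ n / (√(n.factorial : ℝ) * √(n.factorial : ℝ))) := by
      rw [← h2]
    _ = _ := by rw [mul_pow]; field_simp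

end AverageWave
end

/-! ### Averaging over Brownian paths, for real `z`. -/

noncomputable section

namespace AverageWave

variable {d n : ℕ} {S : Type*} [MeasurableSpace S] {μ : Measure ℝ≥0}
  {X B : ℝ≥0 → S → EuclideanSpace ℝ (Fin d)}

/-- The random variable `exp(i z ξ·X_t - ½ ∫_{[0,t]²} R(z (X_s - X_u)) du ds)`. -/
def pathWeight (μ : Measure ℝ≥0) (X : ℝ≥0 → S → EuclideanSpace ℝ (Fin d)) (t : ℝ≥0)
    (ξ : EuclideanSpace ℝ (Fin d)) (z : ℂ) (ω : S) : ℂ :=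
  Complex.exp (Complex.I * z * ((inner ℝ ξ (X t ω) : ℝ) : ℂ) -
    (1 / 2) * ∫ q : ℝ × ℝ in Set.Icc 0 (t : ℝ) ×ˢ Set.Icc 0 (t : ℝ),
      extR μ z (X q.1.toNNReal ω - X q.2.toNNReal ω))

lemma measurable_path (hXm : ∀ t, Measurable (X t)) (hXc : ∀ ω, Continuous fun t => X t ω) :
    Measurable fun q : ℝ × S => X q.1.toNNReal q.2 := by
  have h := measurable_uncurry_of_continuous_of_measurable (u := X) hXc hXm
  exact h.comp (f := fun q : ℝ × S => (q.1.toNNReal, q.2)) (by fun_prop)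

variable [IsFiniteMeasure μ] {Q : Measure S} [IsProbabilityMeasure Q]

/-- Two uses of Fubini move the Brownian expectation inside the time and momentum integrals, where
it is a characteristic function at `z`. Reality of `z` makes all exponentials unimodular. -/
lemma integral_exp_mul_integral_momentTransform (hB : IsStandardBrownian B Q)
    (hXm : ∀ t, Measurable (X t)) (hXc : ∀ ω, Continuous fun t => X t ω)
    (hXB : ∀ᵐ ω ∂Q, ∀ t, X t ω = B t ω) (t : ℝ≥0) (ξ : EuclideanSpace ℝ (Fin d)) (z : ℝ) :
    ∫ ω, Complex.exp (Complex.I * z * ((inner ℝ ξ (X t ω) : ℝ) : ℂ)) *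
        (∫ s in timeSimplex n t, momentTransform μ z (fun j => X (s j).toNNReal ω)) ∂Q =
      expansionTerm μ t ξ n z := by
  have hfin : IsFiniteMeasure ((volume : Measure (Fin n → ℝ)).restrict (timeSimplex n t)) :=
    isFiniteMeasure_restrict.2 isCompact_timeSimplex.measure_lt_top.ne
  have hpath := measurable_path hXm hXc
  have hξ : Measurable fun x : EuclideanSpace ℝ (Fin d) => inner ℝ ξ x := by fun_prop
  have hnorm : ∀ r : ℝ, ‖Complex.exp (Complex.I * z * (r : ℂ))‖ = 1 := by
    intro r
    rw [show Complex.I * z * (r : ℂ) = ((z * r : ℝ) : ℂ) * Complex.I by push_cast; ring,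
      Complex.norm_exp_ofReal_mul_I]
  simp_rw [← integral_const_mul]
  rw [integral_integral_swap]
  swap
  · refine Integrable.of_bound (C := 1 * (momentMeasure d μ n).real Set.univ)
      (Measurable.aestronglyMeasurable ?_) (ae_of_all _ fun w => ?_)
    · simp only [Function.uncurry_def]
      refine Measurable.mul (Complex.measurable_exp.comp ?_)
        ((continuous_momentTransform z).measurable.comp ?_)
      · exact (Complex.measurable_ofReal.comp (hξ.comp ((hXm t).comp measurable_fst))).const_mul _
      · refine measurable_pi_lambda _ fun j => ?_
        exact hpath.comp (f := fun w : S × (Fin n → ℝ) => (w.2 j, w.1)) (by fun_prop)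
    · simp only [Function.uncurry_def, norm_mul, hnorm]
      gcongr
      exact norm_momentTransform_le _ _
  refine setIntegral_congr_fun measurableSet_timeSimplex fun s hs => ?_
  simp only [momentTransform]
  simp_rw [← integral_const_mul, ← Complex.exp_add]
  have hmX : ∀ j, Measurable fun ω => X (s j).toNNReal ω := fun j => hXm _
  have hmS : Measurable fun w : S × (Fin n → EuclideanSpace ℝ (Fin d)) =>
      ∑ j, inner ℝ (w.2 j) (X (s j).toNNReal w.1) :=
    Finset.measurable_sum _ fun j _ => Measurable.inner (by fun_prop)
      ((hmX j).comp measurable_fst)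
  have hcomb : ∀ a b : ℝ, Complex.I * z * (a : ℂ) + -(Complex.I * z) * (b : ℂ) =
      Complex.I * z * ((a - b : ℝ) : ℂ) := fun a b => by push_cast; ring
  simp_rw [hcomb]
  rw [integral_integral_swap]
  swap
  · refine Integrable.of_bound (C := 1)
      (Measurable.aestronglyMeasurable ?_) (ae_of_all _ fun w => (hnorm _).le)
    simp only [Function.uncurry_def]
    refine Complex.measurable_exp.comp (Measurable.const_mul (Complex.measurable_ofReal.comp ?_) _)
    exact (hξ.comp ((hXm t).comp measurable_fst)).sub hmS
  refine integral_congr_ae (ae_of_all _ fun p => ?_)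
  simp only
  rw [← hB.charFun_sub_sum t ξ hs p z, charFun_apply_real]
  have hae : (fun ω => inner ℝ ξ (B t ω) - ∑ l, inner ℝ (p l) (B (s l).toNNReal ω)) =ᵐ[Q]
      fun ω => inner ℝ ξ (X t ω) - ∑ l, inner ℝ (p l) (X (s l).toNNReal ω) := by
    filter_upwards [hXB] with ω hω
    simp_rw [hω]
  have hm : Measurable fun ω => inner ℝ ξ (X t ω) - ∑ l, inner ℝ (p l) (X (s l).toNNReal ω) := by
    refine (hξ.comp (hXm t)).sub (Finset.measurable_sum _ fun j _ => ?_)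
    exact Measurable.inner measurable_const (hmX j)
  rw [Measure.map_congr hae, integral_map hm.aemeasurable (by fun_prop)]
  refine integral_congr_ae (ae_of_all _ fun ω => ?_)
  simp only
  congr 1
  ring

/-- The Feynman-Kac expansion for real `z`. -/
lemma hasSum_expansionTerm_ofReal {Ω : Type*} [MeasurableSpace Ω] {P : Measure Ω}
    {V : EuclideanSpace ℝ (Fin d) → Ω → ℝ} (hV : IsSpectralField μ V P)
    (hB : IsStandardBrownian B Q)
    (hXm : ∀ t, Measurable (X t)) (hXc : ∀ ω, Continuous fun t => X t ω)
    (hXB : ∀ᵐ ω ∂Q, ∀ t, X t ω = B t ω) (t : ℝ≥0) (ξ : EuclideanSpace ℝ (Fin d)) (z : ℝ) :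
    HasSum (fun n => (1 / Complex.I) ^ n * expansionTerm μ t ξ n z)
      (∫ ω, pathWeight μ X t ξ z ω ∂Q) := by
  have hpath := measurable_path hXm hXc
  have hξ : Measurable fun x : EuclideanSpace ℝ (Fin d) => inner ℝ ξ x := by fun_prop
  have hnorm : ∀ r : ℝ, ‖Complex.exp (Complex.I * z * (r : ℂ))‖ = 1 := by
    intro r
    rw [show Complex.I * z * (r : ℂ) = ((z * r : ℝ) : ℂ) * Complex.I by push_cast; ring,
      Complex.norm_exp_ofReal_mul_I]
  have h := hasSum_integral_of_dominated_convergence (μ := Q)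
    (F := fun n ω => Complex.exp (Complex.I * z * ((inner ℝ ξ (X t ω) : ℝ) : ℂ)) *
      ((1 / Complex.I) ^ n *
        ∫ s in timeSimplex n t, momentTransform μ z (fun j => X (s j).toNNReal ω)))
    (f := pathWeight μ X t ξ z)
    (fun n _ => (t * √((spectralMeasure d μ).real Set.univ)) ^ n / √(n.factorial : ℝ))
    (fun n => ?_) (fun n => ae_of_all _ fun ω => ?_)
    (ae_of_all _ fun ω => summable_pow_div_sqrt_factorial _) (integrable_const _)
    (ae_of_all _ fun ω => ?_)
  · refine Eq.mp (congrArg (HasSum · _) (funext fun n => ?_)) h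
    simp_rw [mul_left_comm _ ((1 / Complex.I) ^ n)]
    rw [integral_const_mul, integral_exp_mul_integral_momentTransform hB hXm hXc hXB]
  · have hfin : IsFiniteMeasure ((volume : Measure (Fin n → ℝ)).restrict (timeSimplex n t)) :=
      isFiniteMeasure_restrict.2 isCompact_timeSimplex.measure_lt_top.ne
    refine AEStronglyMeasurable.mul (Measurable.aestronglyMeasurable
      (Complex.measurable_exp.comp
        ((Complex.measurable_ofReal.comp (hξ.comp (hXm t))).const_mul _)))
      (AEStronglyMeasurable.const_mul (StronglyMeasurable.aestronglyMeasurable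
        (StronglyMeasurable.integral_prod_right' (f := fun w : S × (Fin n → ℝ) =>
          momentTransform μ z (fun j => X (w.2 j).toNNReal w.1)) (Measurable.stronglyMeasurable
          ((continuous_momentTransform z).measurable.comp
            (measurable_pi_lambda _ fun j => ?_))))) _)
    exact hpath.comp (f := fun w : S × (Fin n → ℝ) => (w.2 j, w.1)) (by fun_prop)
  · rw [norm_mul, hnorm, one_mul, norm_mul, norm_pow, norm_div, Complex.norm_I, norm_one, div_one,
      one_pow, one_mul]
    exact norm_setIntegral_timeSimplex_le t.coe_nonneg fun s _ => norm_momentTransform_le _ _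
  · have h := (hasSum_momentTransform hV z t
      (x := fun r => X r.toNNReal ω) ((hXc ω).comp continuous_real_toNNReal)).mul_left
      (Complex.exp (Complex.I * z * ((inner ℝ ξ (X t ω) : ℝ) : ℂ)))
    rw [← Complex.exp_add, neg_mul, ← sub_eq_add_neg] at h
    exact h

end AverageWave
end

/-! ### Holomorphy in the sector and passage to its boundary. -/

noncomputable section

namespace AverageWave

/-- The truncated closed sector `|arg z| ≤ π/4`, `|z| ≤ 2`. -/
def closedSector : Set ℂ := {z | |z.im| ≤ z.re ∧ ‖z‖ ≤ 2}

/-- The truncated open sector `|arg z| < π/4`, `|z| < 2`. -/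
def openSector : Set ℂ := {z | |z.im| < z.re ∧ ‖z‖ < 2}

lemma openSector_subset : openSector ⊆ closedSector := fun _ hz => ⟨hz.1.le, hz.2.le⟩

lemma isOpen_openSector : IsOpen openSector :=
  (isOpen_lt (f := fun z : ℂ => |z.im|) (g := fun z => z.re) (by fun_prop) (by fun_prop)).inter
    (isOpen_lt (f := fun z : ℂ => ‖z‖) (g := fun _ => 2) (by fun_prop) (by fun_prop))

lemma convex_openSector : Convex ℝ openSector := by
  have h : openSector = {z : ℂ | z.im < z.re} ∩ {z : ℂ | -z.im < z.re} ∩ Metric.ball 0 2 := by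
    ext z
    simp only [openSector, abs_lt, Set.mem_ofPred_eq, Set.mem_inter_iff, mem_ball_zero_iff]
    constructor
    · rintro ⟨⟨h1, h2⟩, h3⟩
      exact ⟨⟨h2, by linarith⟩, h3⟩
    · rintro ⟨⟨h1, h2⟩, h3⟩
      exact ⟨⟨by linarith, h1⟩, h3⟩
  rw [h]
  refine (Convex.inter ?_ ?_).inter (convex_ball _ _)
  · intro x hx y hy a b ha hb hab
    simp only [Set.mem_ofPred_eq, Complex.add_im, Complex.add_re, Complex.real_smul,
      Complex.re_ofReal_mul, Complex.im_ofReal_mul] at hx hy ⊢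
    rcases ha.eq_or_lt with rfl | ha
    · simp at hab; subst hab; simpa using hy
    · nlinarith [mul_lt_mul_of_pos_left hx ha, mul_le_mul_of_nonneg_left hy.le hb]
  · intro x hx y hy a b ha hb hab
    simp only [Set.mem_ofPred_eq, Complex.add_im, Complex.add_re, Complex.real_smul,
      Complex.re_ofReal_mul, Complex.im_ofReal_mul] at hx hy ⊢
    rcases ha.eq_or_lt with rfl | ha
    · simp at hab; subst hab; simpa using hy
    · nlinarith [mul_lt_mul_of_pos_left hx ha, mul_le_mul_of_nonneg_left hy.le hb]

lemma re_sq_nonneg_of_mem {z : ℂ} (hz : z ∈ closedSector) : 0 ≤ (z ^ 2).re := by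
  have h := sq_le_sq' (by linarith [hz.1, abs_nonneg z.im, neg_abs_le z.im]) hz.1
  rw [sq_abs] at h
  rw [pow_two, Complex.mul_re]
  nlinarith

lemma norm_exp_neg_sq_mul_le {z : ℂ} (hz : z ∈ closedSector) {r : ℝ} (hr : 0 ≤ r) :
    ‖Complex.exp (-(z ^ 2 / 2) * (r : ℂ))‖ ≤ 1 := by
  rw [Complex.norm_exp]
  refine Real.exp_le_one_iff.2 ?_
  have h1 : -(z ^ 2 / 2) * (r : ℂ) = ((-(r / 2) : ℝ) : ℂ) * z ^ 2 := by push_cast; ring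
  rw [h1, Complex.re_ofReal_mul]
  nlinarith [mul_nonneg hr (re_sq_nonneg_of_mem hz)]

/-- The integral of a dominated family of holomorphic functions is holomorphic. -/
lemma differentiableOn_integral_of_dominated {α : Type*} [MeasurableSpace α] {ν : Measure α}
    {F : ℂ → α → ℂ} {U : Set ℂ} (hU : IsOpen U) {g : α → ℝ}
    (hm : ∀ z ∈ U, AEStronglyMeasurable (F z) ν) (hg : Integrable g ν)
    (hb : ∀ᵐ a ∂ν, ∀ z ∈ U, ‖F z a‖ ≤ g a)
    (hd : ∀ᵐ a ∂ν, DifferentiableOn ℂ (fun z => F z a) U) :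
    DifferentiableOn ℂ (fun z => ∫ a, F z a ∂ν) U := by
  intro z₀ hz₀
  obtain ⟨ε, hε, hball⟩ := Metric.isOpen_iff.1 hU z₀ hz₀
  have hcb : ∀ z ∈ Metric.ball z₀ (ε / 2), Metric.closedBall z (ε / 4) ⊆ U := by
    intro z hz w hw
    refine hball ?_
    have := dist_triangle w z z₀
    rw [Metric.mem_ball] at hz ⊢
    rw [Metric.mem_closedBall] at hw
    linarith
  -- Cauchy's estimate on circles of radius `ε/4` about points of the half ball bounds the
  -- derivative by `g/(ε/4)`.
  have h := hasDerivAt_integral_of_dominated_loc_of_deriv_le (μ := ν) (F := F)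
    (F' := fun z a => deriv (fun w => F w a) z) (x₀ := z₀) (s := Metric.ball z₀ (ε / 2))
    (bound := fun a => g a / (ε / 4)) (Metric.ball_mem_nhds _ (by positivity)) ?_ ?_ ?_ ?_
    (hg.div_const _) ?_
  · exact h.2.differentiableAt.differentiableWithinAt
  · filter_upwards [hU.mem_nhds hz₀] with z hz using hm z hz
  · exact hg.mono' (hm z₀ hz₀) (hb.mono fun _ ha => ha z₀ hz₀)
  -- Measurability of the derivative at `z₀`: it is a limit of difference quotients along steps
  -- keeping `z₀ + u k` in the ball.
  · let u : ℕ → ℂ := fun k => ((ε / 2 / (k + 1) : ℝ) : ℂ)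
    have hu0 : Tendsto u atTop (𝓝 0) := by
      have h1 : Tendsto (fun k : ℕ => ε / 2 / ((k : ℝ) + 1)) atTop (𝓝 0) :=
        tendsto_const_nhds.div_atTop
          (tendsto_atTop_add_const_right _ _ tendsto_natCast_atTop_atTop)
      simpa [u, Function.comp_def] using (Complex.continuous_ofReal.tendsto 0).comp h1
    have hune : ∀ k, u k ≠ 0 := fun k => by
      simp only [u, ne_eq, Complex.ofReal_eq_zero]; positivity
    have huU : ∀ k, z₀ + u k ∈ U := fun k => by
      refine hball ?_
      rw [Metric.mem_ball, dist_eq_norm, add_sub_cancel_left, Complex.norm_real,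
        Real.norm_of_nonneg (by positivity)]
      refine (div_le_self (by positivity) ?_).trans_lt (half_lt_self hε)
      linarith [(Nat.cast_nonneg k : (0 : ℝ) ≤ k)]
    refine aestronglyMeasurable_of_tendsto_ae atTop
      (f := fun k a => (u k)⁻¹ • (F (z₀ + u k) a - F z₀ a))
      (fun k => ((hm _ (huU k)).sub (hm _ hz₀)).const_smul (u k)⁻¹) ?_
    filter_upwards [hd] with a ha
    have hda := (ha.differentiableAt (hU.mem_nhds hz₀)).hasDerivAt
    have h1 := hasDerivAt_iff_tendsto_slope_zero.1 hda
    exact h1.comp (tendsto_nhdsWithin_iff.2 ⟨hu0, Eventually.of_forall hune⟩)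
  · filter_upwards [hb, hd] with a ha hda z hz
    refine Complex.norm_deriv_le_of_forall_mem_sphere_norm_le (by positivity) ?_
      fun w hw => ha w (hcb z hz (Metric.sphere_subset_closedBall hw))
    refine DifferentiableOn.diffContOnCl ?_
    exact hda.mono (Metric.closure_ball_subset_closedBall.trans (hcb z hz))
  · filter_upwards [hd] with a hda z hz
    exact (hda.differentiableAt (hU.mem_nhds
      (hcb z hz (Metric.mem_closedBall_self (by positivity))))).hasDerivAt

/-- Functions that are holomorphic in the open sector and continuous up to its boundary. -/
structure IsSectorial (f : ℂ → ℂ) : Prop where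
  cont : ContinuousOn f closedSector
  diff : DifferentiableOn ℂ f openSector

namespace IsSectorial

variable {f g : ℂ → ℂ}

lemma of_differentiable (hf : Differentiable ℂ f) : IsSectorial f :=
  ⟨hf.continuous.continuousOn, hf.differentiableOn⟩

lemma sub (hf : IsSectorial f) (hg : IsSectorial g) : IsSectorial fun z => f z - g z :=
  ⟨hf.cont.sub hg.cont, hf.diff.sub hg.diff⟩

lemma const_mul (c : ℂ) (hf : IsSectorial f) : IsSectorial fun z => c * f z :=
  ⟨continuousOn_const.mul hf.cont, hf.diff.const_mul c⟩

lemma cexp (hf : IsSectorial f) : IsSectorial fun z => Complex.exp (f z) :=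
  ⟨hf.cont.cexp, hf.diff.cexp⟩

lemma integral {α : Type*} [MeasurableSpace α] {ν : Measure α} {F : ℂ → α → ℂ} {b : α → ℝ}
    (hm : ∀ z ∈ closedSector, AEStronglyMeasurable (F z) ν) (hbi : Integrable b ν)
    (hb : ∀ᵐ a ∂ν, ∀ z ∈ closedSector, ‖F z a‖ ≤ b a)
    (hF : ∀ᵐ a ∂ν, IsSectorial fun z => F z a) : IsSectorial fun z => ∫ a, F z a ∂ν where
  cont := continuousOn_of_dominated hm (fun z hz => hb.mono fun _ ha => ha z hz) hbi
    (hF.mono fun _ ha => ha.cont)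
  diff := differentiableOn_integral_of_dominated isOpen_openSector
    (fun z hz => hm z (openSector_subset hz)) hbi
    (hb.mono fun _ ha z hz => ha z (openSector_subset hz)) (hF.mono fun _ ha => ha.diff)

lemma tsum {F : ℕ → ℂ → ℂ} {b : ℕ → ℝ} (hF : ∀ n, IsSectorial (F n)) (hbs : Summable b)
    (hb : ∀ n, ∀ z ∈ closedSector, ‖F n z‖ ≤ b n) : IsSectorial fun z => ∑' n, F n z where
  cont := continuousOn_tsum (fun n => (hF n).cont) hbs hb
  diff := Complex.differentiableOn_tsum_of_summable_norm hbs (fun n => (hF n).diff)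
    isOpen_openSector fun n z hz => hb n z (openSector_subset hz)

end IsSectorial

lemma sqrtI_eq : sqrtI = ((√2 / 2 : ℝ) : ℂ) + ((√2 / 2 : ℝ) : ℂ) * Complex.I := by
  have h2 : ((√2 : ℝ) : ℂ) ≠ 0 := by
    rw [Complex.ofReal_ne_zero]; positivity
  have h : ((√2 : ℝ) : ℂ) ^ 2 = 2 := by
    rw [← Complex.ofReal_pow, Real.sq_sqrt (by norm_num)]; norm_num
  rw [sqrtI, div_eq_iff h2]
  push_cast
  linear_combination (-(1 + Complex.I) / 2) * h

lemma sqrtI_re : sqrtI.re = √2 / 2 := by simp [sqrtI_eq]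

lemma sqrtI_im : sqrtI.im = √2 / 2 := by simp [sqrtI_eq]

lemma norm_sqrtI : ‖sqrtI‖ = 1 := by
  have h := congrArg norm sqrtI_sq
  rw [norm_pow, Complex.norm_I] at h
  exact (pow_eq_one_iff_of_nonneg (norm_nonneg _) two_ne_zero).1 h

lemma sqrtI_mem_closedSector : sqrtI ∈ closedSector := by
  refine ⟨?_, by rw [norm_sqrtI]; norm_num⟩
  rw [sqrtI_re, sqrtI_im, abs_of_nonneg (by positivity)]

/-- Sectorial functions that agree on the positive half line agree at `√i`. -/
lemma IsSectorial.eq_at_sqrtI {f g : ℂ → ℂ} (hf : IsSectorial f) (hg : IsSectorial g)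
    (h : ∀ x : ℝ, f x = g x) : f sqrtI = g sqrtI := by
  have h1 : (1 : ℂ) ∈ openSector := by simp [openSector]
  have heq : Set.EqOn f g openSector := by
    refine (hf.diff.analyticOnNhd isOpen_openSector).eqOn_of_preconnected_of_frequently_eq
      (hg.diff.analyticOnNhd isOpen_openSector) convex_openSector.isPreconnected h1 ?_
    -- Real points accumulating at `1`, an interior point of the sector, suffice for the identity
    -- theorem.
    have hu : Tendsto (fun k : ℕ => ((1 + 1 / ((k : ℝ) + 1) : ℝ) : ℂ)) atTop (𝓝[≠] 1) := by
      refine tendsto_nhdsWithin_iff.2 ⟨?_, Eventually.of_forall fun k => ?_⟩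
      · have h2 := (tendsto_one_div_add_atTop_nhds_zero_nat (𝕜 := ℝ)).const_add 1
        simpa [Function.comp_def] using (Complex.continuous_ofReal.tendsto _).comp h2
      · have : (1 : ℝ) / ((k : ℝ) + 1) ≠ 0 := by positivity
        rw [Set.mem_compl_singleton_iff]
        intro hk
        apply this
        have hk' : (1 + 1 / ((k : ℝ) + 1) : ℝ) = 1 := by exact_mod_cast hk
        linarith
    exact hu.frequently (Frequently.of_forall fun k => h _)
  -- `√i` lies on the boundary ray `Im z = Re z`; a small positive real shift moves it into the open
  -- sector.
  have hv : Tendsto (fun k : ℕ => sqrtI + ((1 / ((k : ℝ) + 1) : ℝ) : ℂ)) atTop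
      (𝓝 sqrtI) := by
    have h2 := (Complex.continuous_ofReal.tendsto _).comp
      (tendsto_one_div_add_atTop_nhds_zero_nat (𝕜 := ℝ))
    simpa using h2.const_add sqrtI
  have hvU : ∀ᶠ k : ℕ in atTop, sqrtI + ((1 / ((k : ℝ) + 1) : ℝ) : ℂ) ∈ openSector := by
    have hn : ∀ᶠ z : ℂ in 𝓝 sqrtI, ‖z‖ < 2 :=
      continuous_norm.continuousAt.eventually_lt continuousAt_const (by rw [norm_sqrtI]; norm_num)
    filter_upwards [hv.eventually hn] with k hk
    refine ⟨?_, hk⟩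
    have : (0 : ℝ) < 1 / ((k : ℝ) + 1) := by positivity
    rw [Complex.add_im, Complex.add_re, Complex.ofReal_im, Complex.ofReal_re, sqrtI_re, sqrtI_im,
      add_zero, abs_of_nonneg (by positivity)]
    linarith
  have hvK := tendsto_nhdsWithin_iff.2 ⟨hv, hvU.mono fun k hk => openSector_subset hk⟩
  have hfl := (hf.cont _ sqrtI_mem_closedSector).tendsto.comp hvK
  have hgl := (hg.cont _ sqrtI_mem_closedSector).tendsto.comp hvK
  refine tendsto_nhds_unique (hfl.congr' ?_) hgl
  filter_upwards [hvU] with k hk using heq hk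

end AverageWave
end

/-! ### Both sides of the expansion are sectorial. -/

noncomputable section

namespace AverageWave

variable {d n : ℕ} {S : Type*} {μ : Measure ℝ≥0}
  {X B : ℝ≥0 → S → EuclideanSpace ℝ (Fin d)} {z : ℂ}

/-- The exponent is `-z²/2` times a nonnegative real, the form in which `Re z² ≥ 0` gives the bound
`1`. -/
lemma extR_eq (z : ℂ) (x : EuclideanSpace ℝ (Fin d)) :
    extR μ z x = ∫ l : ℝ≥0, Complex.exp (-(z ^ 2 / 2) * (((l * ‖x‖) ^ 2 : ℝ) : ℂ)) ∂μ := by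
  refine integral_congr_ae (ae_of_all _ fun l => ?_)
  simp only
  congr 1
  push_cast
  ring

/-- The energy `∫_{[0,t]²} R(z (x_s - x_u)) du ds` of a path. -/
def pathEnergy (μ : Measure ℝ≥0) (t : ℝ) (x : ℝ → EuclideanSpace ℝ (Fin d)) (z : ℂ) : ℂ :=
  ∫ q : ℝ × ℝ in Set.Icc 0 t ×ˢ Set.Icc 0 t, extR μ z (x q.1 - x q.2)

lemma pathWeight_eq (t : ℝ≥0) (ξ : EuclideanSpace ℝ (Fin d)) (z : ℂ) (ω : S) :
    pathWeight μ X t ξ z ω = Complex.exp (Complex.I * z * ((inner ℝ ξ (X t ω) : ℝ) : ℂ) -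
      (1 / 2) * pathEnergy μ t (fun r => X r.toNNReal ω) z) := rfl

variable [IsFiniteMeasure μ]

lemma isSectorial_exp (r : ℝ) : IsSectorial fun z => Complex.exp (-(z ^ 2 / 2) * (r : ℂ)) :=
  .of_differentiable (by fun_prop)

lemma isSectorial_extR (x : EuclideanSpace ℝ (Fin d)) : IsSectorial fun z => extR μ z x := by
  simp_rw [extR_eq]
  exact IsSectorial.integral (b := fun _ => 1)
    (fun z _ => Continuous.aestronglyMeasurable (by fun_prop)) (integrable_const _)
    (ae_of_all _ fun l z hz => norm_exp_neg_sq_mul_le hz (by positivity))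
    (ae_of_all _ fun l => isSectorial_exp _)

lemma norm_extR_le (hz : z ∈ closedSector) (x : EuclideanSpace ℝ (Fin d)) :
    ‖extR μ z x‖ ≤ μ.real Set.univ := by
  rw [extR_eq]
  refine (norm_integral_le_of_norm_le_const (C := 1)
    (ae_of_all _ fun l => norm_exp_neg_sq_mul_le hz (by positivity))).trans (one_mul _).le

lemma continuous_extR (hz : z ∈ closedSector) :
    Continuous fun x : EuclideanSpace ℝ (Fin d) => extR μ z x := by
  simp_rw [extR_eq]
  exact continuous_of_dominated (bound := fun _ => 1)
    (fun x => Continuous.aestronglyMeasurable (by fun_prop))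
    (fun x => ae_of_all _ fun l => norm_exp_neg_sq_mul_le hz (by positivity)) (integrable_const _)
    (ae_of_all _ fun l => by fun_prop)

lemma isFiniteMeasure_restrict_square (t : ℝ) :
    IsFiniteMeasure ((volume : Measure (ℝ × ℝ)).restrict (Set.Icc 0 t ×ˢ Set.Icc 0 t)) :=
  isFiniteMeasure_restrict.2 (isCompact_Icc.prod isCompact_Icc).measure_lt_top.ne

lemma isSectorial_pathEnergy (t : ℝ) {x : ℝ → EuclideanSpace ℝ (Fin d)} (hx : Continuous x) :
    IsSectorial (pathEnergy μ t x) := by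
  have := isFiniteMeasure_restrict_square t
  exact IsSectorial.integral (b := fun _ => μ.real Set.univ)
    (fun z hz => ((continuous_extR hz).comp
      (by fun_prop : Continuous fun q : ℝ × ℝ => x q.1 - x q.2)).aestronglyMeasurable)
    (integrable_const _) (ae_of_all _ fun q z hz => norm_extR_le hz _)
    (ae_of_all _ fun q => isSectorial_extR _)

lemma norm_pathEnergy_le (hz : z ∈ closedSector) (t : ℝ) (x : ℝ → EuclideanSpace ℝ (Fin d)) :
    ‖pathEnergy μ t x z‖ ≤ μ.real Set.univ *
      (volume : Measure (ℝ × ℝ)).real (Set.Icc 0 t ×ˢ Set.Icc 0 t) :=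
  norm_setIntegral_le_of_norm_le_const (isCompact_Icc.prod isCompact_Icc).measure_lt_top
    fun _ _ => norm_extR_le hz _

/-- With `r = ξ·X_t` and `|Im z| ≤ 2`, the oscillating factor has modulus at most `exp(2|r|) ≤
exp(2r) + exp(-2r)`. The bound is uniform over the truncated sector, and Gaussian tails make it
integrable. -/
lemma norm_pathWeight_le (t : ℝ≥0) (ξ : EuclideanSpace ℝ (Fin d)) (ω : S)
    (hz : z ∈ closedSector) :
    ‖pathWeight μ X t ξ z ω‖ ≤
      (Real.exp (2 * inner ℝ ξ (X t ω)) + Real.exp (-2 * inner ℝ ξ (X t ω))) *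
        Real.exp (μ.real Set.univ *
          (volume : Measure (ℝ × ℝ)).real (Set.Icc 0 (t : ℝ) ×ˢ Set.Icc 0 (t : ℝ))) := by
  rw [pathWeight_eq, sub_eq_add_neg, Complex.exp_add, norm_mul]
  refine mul_le_mul ?_ ?_ (norm_nonneg _) (by positivity)
  · set r : ℝ := inner ℝ ξ (X t ω)
    have him : |z.im| ≤ 2 := (Complex.abs_im_le_norm z).trans hz.2
    have hre : (Complex.I * z * (r : ℂ)).re = -z.im * r := by
      simp
    rw [Complex.norm_exp, hre]
    have h1 : -z.im * r ≤ 2 * |r| :=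
      (le_abs_self _).trans (by rw [abs_mul, abs_neg]; gcongr)
    rcases abs_cases r with ⟨h, -⟩ | ⟨h, -⟩ <;> rw [h] at h1
    · exact (Real.exp_le_exp.2 h1).trans (le_add_of_nonneg_right (Real.exp_pos _).le)
    · refine (Real.exp_le_exp.2 (h1.trans_eq ?_)).trans
        (le_add_of_nonneg_left (Real.exp_pos _).le)
      ring
  · rw [Complex.norm_exp]
    refine Real.exp_le_exp.2 ((Complex.re_le_norm _).trans ?_)
    rw [norm_neg, norm_mul]
    refine le_trans ?_ (norm_pathEnergy_le hz t fun r => X r.toNNReal ω)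
    refine mul_le_of_le_one_left (norm_nonneg _) (by norm_num)

variable [MeasurableSpace S]

lemma measurable_pathWeight (hXm : ∀ t, Measurable (X t))
    (hXc : ∀ ω, Continuous fun t => X t ω) (t : ℝ≥0) (ξ : EuclideanSpace ℝ (Fin d))
    (hz : z ∈ closedSector) : Measurable (pathWeight μ X t ξ z) := by
  have := isFiniteMeasure_restrict_square (t : ℝ)
  have hpath := measurable_path hXm hXc
  have hξ : Measurable fun x : EuclideanSpace ℝ (Fin d) => inner ℝ ξ x := by fun_prop
  refine Complex.measurable_exp.comp (Measurable.sub
    ((Complex.measurable_ofReal.comp (hξ.comp (hXm t))).const_mul _) (Measurable.const_mul ?_ _))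
  refine (StronglyMeasurable.integral_prod_right' (f := fun w : S × (ℝ × ℝ) =>
    extR μ z (X w.2.1.toNNReal w.1 - X w.2.2.toNNReal w.1))
    (Measurable.stronglyMeasurable ((continuous_extR hz).measurable.comp ?_))).measurable
  exact (hpath.comp (f := fun w : S × (ℝ × ℝ) => (w.2.1, w.1)) (by fun_prop)).sub
    (hpath.comp (f := fun w : S × (ℝ × ℝ) => (w.2.2, w.1)) (by fun_prop))

section Expectation

variable {Q : Measure S} [IsProbabilityMeasure Q]

lemma integrable_pathWeight_bound (hB : IsStandardBrownian B Q)
    (hXB : ∀ᵐ ω ∂Q, ∀ t, X t ω = B t ω) (t : ℝ≥0) (ξ : EuclideanSpace ℝ (Fin d)) (c : ℝ) :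
    Integrable (fun ω => (Real.exp (2 * inner ℝ ξ (X t ω)) +
      Real.exp (-2 * inner ℝ ξ (X t ω))) * c) Q := by
  refine Integrable.congr (((hB.integrable_exp t ξ 2).add
    (hB.integrable_exp t ξ (-2))).mul_const c) ?_
  filter_upwards [hXB] with ω hω
  simp [hω]

lemma integrable_pathWeight (hB : IsStandardBrownian B Q)
    (hXm : ∀ t, Measurable (X t)) (hXc : ∀ ω, Continuous fun t => X t ω)
    (hXB : ∀ᵐ ω ∂Q, ∀ t, X t ω = B t ω) (t : ℝ≥0) (ξ : EuclideanSpace ℝ (Fin d))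
    (hz : z ∈ closedSector) : Integrable (pathWeight μ X t ξ z) Q :=
  (integrable_pathWeight_bound hB hXB t ξ _).mono'
    (measurable_pathWeight hXm hXc t ξ hz).aestronglyMeasurable
    (ae_of_all _ fun ω => norm_pathWeight_le t ξ ω hz)

lemma isSectorial_integral_pathWeight (hB : IsStandardBrownian B Q)
    (hXm : ∀ t, Measurable (X t)) (hXc : ∀ ω, Continuous fun t => X t ω)
    (hXB : ∀ᵐ ω ∂Q, ∀ t, X t ω = B t ω) (t : ℝ≥0) (ξ : EuclideanSpace ℝ (Fin d)) :
    IsSectorial fun z => ∫ ω, pathWeight μ X t ξ z ω ∂Q := by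
  refine IsSectorial.integral (F := fun z ω => pathWeight μ X t ξ z ω)
    (fun _ hz => (measurable_pathWeight hXm hXc t ξ hz).aestronglyMeasurable)
    (integrable_pathWeight_bound hB hXB t ξ _)
    (ae_of_all _ fun ω _ hz => norm_pathWeight_le t ξ ω hz) (ae_of_all _ fun ω => ?_)
  simp_rw [pathWeight_eq]
  have h1 : IsSectorial fun z => Complex.I * z * ((inner ℝ ξ (X t ω) : ℝ) : ℂ) :=
    .of_differentiable (by fun_prop)
  have h2 := isSectorial_pathEnergy (μ := μ) (t : ℝ) ((hXc ω).comp continuous_real_toNNReal)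
  exact (h1.sub (h2.const_mul (1 / 2))).cexp

end Expectation

/-- On the simplex the grid times decrease, so all weights are nonnegative and the kernel stays
bounded by `1` throughout the closed sector. -/
lemma phaseForm_nonneg {t : ℝ} (ht : 0 ≤ t) (ξ : EuclideanSpace ℝ (Fin d)) {s : Fin n → ℝ}
    (hs : s ∈ timeSimplex n t) (p : Fin n → EuclideanSpace ℝ (Fin d)) :
    0 ≤ phaseForm t ξ s p :=
  Finset.sum_nonneg fun _ _ => mul_nonneg (by positivity)
    (sub_nonneg.2 (timeGrid_antitone hs ht (Fin.castSucc_lt_succ).le))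

lemma norm_integral_exp_phaseForm_le {t : ℝ} (ht : 0 ≤ t) (ξ : EuclideanSpace ℝ (Fin d))
    {s : Fin n → ℝ} (hs : s ∈ timeSimplex n t) (hz : z ∈ closedSector) :
    ‖∫ p, Complex.exp (-(z ^ 2 / 2) * (phaseForm t ξ s p : ℂ)) ∂(momentMeasure d μ n)‖ ≤
      (momentMeasure d μ n).real Set.univ :=
  (norm_integral_le_of_norm_le_const (C := 1) (ae_of_all _ fun p =>
    norm_exp_neg_sq_mul_le hz (phaseForm_nonneg ht ξ hs p))).trans (one_mul _).le

lemma isSectorial_expansionTerm {t : ℝ} (ht : 0 ≤ t) (ξ : EuclideanSpace ℝ (Fin d)) (n : ℕ) :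
    IsSectorial (expansionTerm μ t ξ n) := by
  have hfin : IsFiniteMeasure ((volume : Measure (Fin n → ℝ)).restrict (timeSimplex n t)) :=
    isFiniteMeasure_restrict.2 isCompact_timeSimplex.measure_lt_top.ne
  have hc := continuous_phaseForm (n := n) t ξ
  refine IsSectorial.integral (b := fun _ => (momentMeasure d μ n).real Set.univ)
    (fun z hz => ?_) (integrable_const _)
    (ae_restrict_of_forall_mem measurableSet_timeSimplex fun s hs z hz =>
      norm_integral_exp_phaseForm_le ht ξ hs hz)
    (ae_restrict_of_forall_mem measurableSet_timeSimplex fun s hs => ?_)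
  · exact (StronglyMeasurable.integral_prod_right' (f := fun w : (Fin n → ℝ) × _ =>
      Complex.exp (-(z ^ 2 / 2) * (phaseForm t ξ w.1 w.2 : ℂ)))
      (Continuous.stronglyMeasurable (by fun_prop))).aestronglyMeasurable
  · have hs' : Continuous (phaseForm t ξ s) := Continuous.uncurry_left (f := phaseForm t ξ) s hc
    exact IsSectorial.integral (b := fun _ => 1)
      (fun z _ => Continuous.aestronglyMeasurable (by fun_prop)) (integrable_const _)
      (ae_of_all _ fun p z hz => norm_exp_neg_sq_mul_le hz (phaseForm_nonneg ht ξ hs p))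
      (ae_of_all _ fun p => isSectorial_exp _)

lemma norm_expansionTerm_le {t : ℝ} (ht : 0 ≤ t) (ξ : EuclideanSpace ℝ (Fin d)) (n : ℕ)
    (hz : z ∈ closedSector) : ‖(1 / Complex.I) ^ n * expansionTerm μ t ξ n z‖ ≤
      (t * √((spectralMeasure d μ).real Set.univ)) ^ n / √(n.factorial : ℝ) := by
  rw [norm_mul, norm_pow, norm_div, Complex.norm_I, norm_one, div_one, one_pow, one_mul]
  exact norm_setIntegral_timeSimplex_le ht fun s hs => norm_integral_exp_phaseForm_le ht ξ hs hz

/-- The Feynman-Kac expansion at `z = √i`. -/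
lemma hasSum_expansionTerm_sqrtI {Ω : Type*} [MeasurableSpace Ω] {P : Measure Ω}
    {V : EuclideanSpace ℝ (Fin d) → Ω → ℝ} (hV : IsSpectralField μ V P)
    {Q : Measure S} [IsProbabilityMeasure Q] (hB : IsStandardBrownian B Q)
    (hXm : ∀ t, Measurable (X t)) (hXc : ∀ ω, Continuous fun t => X t ω)
    (hXB : ∀ᵐ ω ∂Q, ∀ t, X t ω = B t ω) (t : ℝ≥0) (ξ : EuclideanSpace ℝ (Fin d)) :
    HasSum (fun n => (1 / Complex.I) ^ n * expansionTerm μ t ξ n sqrtI)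
      (∫ ω, pathWeight μ X t ξ sqrtI ω ∂Q) := by
  have hsum := summable_pow_div_sqrt_factorial
    (t * √((spectralMeasure d μ).real Set.univ))
  -- The sum of the series and the path expectation are both sectorial and agree at real `z`. At
  -- `√i` the series still converges by the same majorant.
  rw [← IsSectorial.eq_at_sqrtI
    (IsSectorial.tsum (fun n => (isSectorial_expansionTerm t.coe_nonneg ξ n).const_mul _)
      hsum fun n z hz => norm_expansionTerm_le t.coe_nonneg ξ n hz)
    (isSectorial_integral_pathWeight (μ := μ) hB hXm hXc hXB t ξ)
    fun x => (hasSum_expansionTerm_ofReal hV hB hXm hXc hXB t ξ x).tsum_eq]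
  exact (Summable.of_norm_bounded hsum fun n =>
    norm_expansionTerm_le t.coe_nonneg ξ n sqrtI_mem_closedSector).hasSum

end AverageWave

end

/-! ### The averaged solution as a Brownian expectation. -/

theorem proposition2p1 {d : ℕ} {Ω : Type*} [MeasurableSpace Ω] (P : Measure Ω)
    [IsProbabilityMeasure P] {S : Type*} [MeasurableSpace S] (Q : Measure S)
    [IsProbabilityMeasure Q] (μ : Measure ℝ≥0) [IsFiniteMeasure μ]
    (V : EuclideanSpace ℝ (Fin d) → Ω → ℝ) (hV : IsGaussianProcess V P)
    (hmean : ∀ x, ∫ ω, V x ω ∂P = 0)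
    (hcov : ∀ x y, ((∫ ω, V (x + y) ω * V y ω ∂P : ℝ) : ℂ) = AverageWave.rho μ ((‖x‖ : ℝ) : ℂ))
    (B : ℝ≥0 → S → EuclideanSpace ℝ (Fin d)) (hB : AverageWave.IsStandardBrownian B Q)
    (φ₀ : EuclideanSpace ℝ (Fin d) → ℂ) (hφ₀ : Integrable φ₀) :
    (∃! φ : ℝ≥0 → EuclideanSpace ℝ (Fin d) → Lp ℂ 2 P,
      AverageWave.IsDuhamelSolution V P φ₀ φ) ∧
    ∀ φ : ℝ≥0 → EuclideanSpace ℝ (Fin d) → Lp ℂ 2 P, AverageWave.IsDuhamelSolution V P φ₀ φ →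
      ∀ (t : ℝ≥0) (ξ : EuclideanSpace ℝ (Fin d)),
        Integrable (φ t ξ) P ∧
        Integrable (AverageWave.feynmanKacWeight μ B t ξ) Q ∧
        ∫ ω, φ t ξ ω ∂P =
          AverageWave.fourierHat φ₀ ξ * ∫ ω, AverageWave.feynmanKacWeight μ B t ξ ω ∂Q := by
  have hF : AverageWave.IsSpectralField μ V P := ⟨hV, hmean, hcov⟩
  refine ⟨AverageWave.existsUnique_isDuhamelSolution hF hφ₀, fun φ hφ t ξ => ?_⟩
  obtain ⟨X, hXm, hXc, hXB⟩ := hB.exists_continuous_version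
  -- Indistinguishability at all times is needed here, since the energy involves the whole path.
  have hae : AverageWave.pathWeight μ X t ξ AverageWave.sqrtI =ᵐ[Q]
      AverageWave.feynmanKacWeight μ B t ξ := by
    filter_upwards [hXB] with ω hω
    simp only [AverageWave.pathWeight, AverageWave.feynmanKacWeight, hω]
  refine ⟨(Lp.memLp (φ t ξ)).integrable one_le_two,
    (AverageWave.integrable_pathWeight hB hXm hXc hXB t ξ
      AverageWave.sqrtI_mem_closedSector).congr hae, ?_⟩
  rw [← integral_congr_ae hae]
  exact (hφ.hasSum_integral hF t ξ).unique
    ((AverageWave.hasSum_expansionTerm_sqrtI hF hB hXm hXc hXB t ξ).mul_left _)
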